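/- All algebras are over $\mathbb R$. A Poisson algebra is a commutative unital algebra with a Lie bracket $\{\cdot,\cdot\}$ satisfying the Leibniz rule; "generated" means generated as a Poisson algebra. **The Racah algebra.** $R(n)$ is the Poisson algebra with generators $C_i$ and $P_{ij}=P_{ji}$ ($1\le i\neq j\le n$) and the following defining relations, in which different letters denote different indices: the $C_i$ are central, $\{P_{ij},P_{kl}\}=0$, and, with $F_{ijk}:=\tfrac12\{P_{ij},P_{jk}\}$, $$F_{ijk}=-F_{jik}=-F_{ikj},\qquad \{P_{jk},F_{ijk}\}=P_{ik}P_{jk}-P_{jk}P_{ij}+2P_{ik}C_j-2P_{ij}C_k,\qquad \{P_{kl},F_{ijk}\}=P_{ik}P_{jl}-P_{il}P_{jk},$$ $$\{F_{ijk},F_{jkl}\}=F_{jkl}P_{ij}-F_{ikl}(P_{jk}+2C_j)-F_{ijk}P_{jl},\qquad \{F_{ijk},F_{klm}\}=F_{ilm}P_{jk}-P_{ik}F_{jlm}.$$ For $A\subseteq[n]=\{1,\dots,n\}$ put $C_A:=\sum_{i<j,\ i,j\in A}P_{ij}+\sum_{i\in A}C_i$, and put $\mathcal L_m:=C_{\{1,\dots,m\}}$,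 $\mathcal R_m:=C_{\{m,\dots,n\}}$. **The Poisson coalgebra.** Let $\mathfrak A=\mathbb R[J_+,J_-,J_3]$ with $\{J_-,J_+\}=2J_3$, $\{J_3,J_\pm\}=\pm J_\pm$, primitive coproduct $\Delta(J_\sigma)=J_\sigma\otimes1+1\otimes J_\sigma$ and Casimir $C=J_3^2-J_+J_-$. In $\mathfrak A^{\otimes n}$ with its standard Poisson structure let $C^{\mathfrak A}_A$ be the function $C$ evaluated at $\sum_{i\in A}J_\sigma^{(i)}$, where $J_\sigma^{(i)}$ is $J_\sigma$ at the site $i$, and let $R^{\mathfrak A}(n)\subseteq\mathfrak A^{\otimes n}$ be the Poisson subalgebra generated by all $C^{\mathfrak A}_A$, $A\subseteq[n]$. Let $\mathcal L^{\mathfrak A}_m=\Delta_L^{[m]}(C)$, placed on the sites $1,\dots,m$, and $\mathcal R^{\mathfrak A}_m=\Delta_R^{[n-m+1]}(C)$, placed on the sites $m,\dots,n$, be the left and right Casimirs, where $\Delta_L^{[1]}=\Delta_R^{[1]}=\mathrm{id}$, $\Delta_L^{[m]}=(\mathrm{id}^{\otimes(m-2)}\otimes\Delta)\circ\Delta_L^{[m-1]}$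 and $\Delta_R^{[m]}=(\Delta\otimes\mathrm{id}^{\otimes(m-2)})\circ\Delta_R^{[m-1]}$. **Proposition.** Let $n>3$, $2\le k\le n-1$, $K_1=\{1,\dots,k-1\}$, $K_2=\{k\}$, $K_3=\{k+1,\dots,n\}$, and $K_B=\bigcup_{q\in B}K_q$ for $B\subseteq\{1,2,3\}$. Put $\mathcal M_k:=\mathcal L_n-\mathcal L_k-\mathcal R_k+\mathcal L_{k-1}+C_k+\mathcal R_{k+1}$ and $\mathcal F_k:=\tfrac12\{\mathcal L_k,\mathcal R_k\}$, and let $S_{(n,k)}$ be the Poisson subalgebra generated by $\mathcal L_{k-1},C_k,\mathcal R_{k+1},\mathcal L_k,\mathcal R_k,\mathcal L_n$. Then: 1. There is exactly one Poisson morphism $\theta_k:R(3)\to R(n)$ with $\theta_k(C_B)=C_{K_B}$ for all $B$, and it is injective. 2. $\theta_k(C_1)=\mathcal L_{k-1}$, $\theta_k(C_2)=C_k$, $\theta_k(C_3)=\mathcal R_{k+1}$, $\theta_k(C_{12})=\mathcal L_k$, $\theta_k(C_{23})=\mathcal R_k$, $\theta_k(C_{13})=\mathcal M_k$, $\theta_k(C_{123})=\mathcal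 L_n=\mathcal R_1$. 3. The image of $\theta_k$ is generated by $\mathcal L_{k-1},C_k,\mathcal R_{k+1},\mathcal L_k,\mathcal R_k,\mathcal M_k,\mathcal L_n$, and it equals $S_{(n,k)}$. 4. In $S_{(n,k)}$ the elements $\mathcal L_{k-1},C_k,\mathcal R_{k+1},\mathcal L_n$ are central, $\mathcal F_k=\tfrac12\{\mathcal R_k,\mathcal M_k\}=\tfrac12\{\mathcal M_k,\mathcal L_k\}$, and $$\{\mathcal L_k,\mathcal F_k\}=\mathcal R_k\mathcal L_k-\mathcal L_k\mathcal M_k+(C_k-\mathcal L_{k-1})(\mathcal R_{k+1}-\mathcal L_n)=\mathcal L_k^2+2\mathcal R_k\mathcal L_k-(\mathcal L_n+\mathcal L_{k-1}+C_k+\mathcal R_{k+1})\mathcal L_k+(C_k-\mathcal L_{k-1})(\mathcal R_{k+1}-\mathcal L_n),$$ $$\{\mathcal R_k,\mathcal F_k\}=\mathcal M_k\mathcal R_k-\mathcal R_k\mathcal L_k+(\mathcal R_{k+1}-C_k)(\mathcal L_{k-1}-\mathcal L_n)=-\mathcal R_k^2-2\mathcal L_k\mathcal R_k+(\mathcal L_n+\mathcal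 L_{k-1}+C_k+\mathcal R_{k+1})\mathcal R_k+(\mathcal R_{k+1}-C_k)(\mathcal L_{k-1}-\mathcal L_n),$$ $$\{\mathcal M_k,\mathcal F_k\}=\mathcal L_k\mathcal M_k-\mathcal M_k\mathcal R_k+(\mathcal L_{k-1}-\mathcal R_{k+1})(C_k-\mathcal L_n).$$ 5. $S_{(n,k)}$ is isomorphic to $R(3)$ as a Poisson algebra. The same five assertions hold in the coalgebra, that is, with $R^{\mathfrak A}(3)$, $R^{\mathfrak A}(n)$, $C^{\mathfrak A}_A$, $\mathcal L^{\mathfrak A}_m$, $\mathcal R^{\mathfrak A}_m$ in place of $R(3)$, $R(n)$, $C_A$, $\mathcal L_m$, $\mathcal R_m$, giving an injective morphism $\theta_k^{\mathfrak A}:R^{\mathfrak A}(3)\to R^{\mathfrak A}(n)$. Moreover there are surjective Poisson morphisms $\rho_m:R(m)\to R^{\mathfrak A}(m)$, $m\in\{3,n\}$, with $\rho_m(C_A)=C_A^{\mathfrak A}$ for all $A$; they satisfy $\rho_n(\mathcal L_m)=\mathcal L^{\mathfrak A}_m$ and $\rho_n(\mathcal R_m)=\mathcal R^{\mathfrak A}_m$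 for $1\le m\le n$, and $\rho_n\circ\theta_k=\theta^{\mathfrak A}_k\circ\rho_3$. -/

import Mathlib

noncomputable section

/-! ### Poisson algebras over `ℝ` -/

/-- A (commutative, unital) real Poisson algebra: a Lie bracket `pb` that is a derivation in
each argument. -/
class PoissonAlgebra (A : Type*) [CommRing A] [Algebra ℝ A] where
  pb : A →ₗ[ℝ] A →ₗ[ℝ] A
  pb_self : ∀ a, pb a a = 0
  pb_jacobi : ∀ a b c, pb a (pb b c) + pb b (pb c a) + pb c (pb a b) = 0
  pb_mul : ∀ a b c, pb a (b * c) = pb a b * c + b * pb a c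

open PoissonAlgebra (pb)

/-- Morphisms of Poisson algebras. -/
structure PoissonHom (A B : Type*) [CommRing A] [Algebra ℝ A] [PoissonAlgebra A]
    [CommRing B] [Algebra ℝ B] [PoissonAlgebra B] extends A →ₐ[ℝ] B where
  map_pb' : ∀ a b, toFun (pb a b) = pb (toFun a) (toFun b)

/-- Isomorphisms of Poisson algebras. -/
structure PoissonEquiv (A B : Type*) [CommRing A] [Algebra ℝ A] [PoissonAlgebra A]
    [CommRing B] [Algebra ℝ B] [PoissonAlgebra B] extends A ≃ₐ[ℝ] B where
  map_pb' : ∀ a b, toFun (pb a b) = pb (toFun a) (toFun b)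

/-- Poisson subalgebras: unital subalgebras closed under the bracket. -/
structure PoissonSubalgebra (A : Type*) [CommRing A] [Algebra ℝ A] [PoissonAlgebra A]
    extends Subalgebra ℝ A where
  pb_mem' : ∀ {a b}, a ∈ carrier → b ∈ carrier → pb a b ∈ carrier

section PoissonBasics

variable {A B : Type*} [CommRing A] [Algebra ℝ A] [PoissonAlgebra A]
  [CommRing B] [Algebra ℝ B] [PoissonAlgebra B]

instance : CoeFun (PoissonHom A B) (fun _ => A → B) := ⟨fun θ => θ.toAlgHom⟩

theorem PoissonHom.map_pb (θ : PoissonHom A B) (a b : A) : θ (pb a b) = pb (θ a) (θ b) :=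
  θ.map_pb' a b

instance (S : PoissonSubalgebra A) : PoissonAlgebra S.toSubalgebra where
  pb := LinearMap.mk₂ ℝ (fun a b => ⟨pb (a : A) (b : A), S.pb_mem' a.2 b.2⟩)
    (fun a b c => Subtype.ext (by simp)) (fun r a b => Subtype.ext (by simp))
    (fun a b c => Subtype.ext (by simp)) (fun r a b => Subtype.ext (by simp))
  pb_self a := Subtype.ext (PoissonAlgebra.pb_self (a : A))
  pb_jacobi a b c := Subtype.ext (PoissonAlgebra.pb_jacobi (a : A) b c)
  pb_mul a b c := Subtype.ext (PoissonAlgebra.pb_mul (a : A) b c)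

/-- The Poisson subalgebra generated by a set: the intersection of all Poisson subalgebras
containing it. -/
def PoissonSubalgebra.adjoin (s : Set A) : PoissonSubalgebra A where
  carrier := {a | ∀ S : PoissonSubalgebra A, s ⊆ S.carrier → a ∈ S.carrier}
  mul_mem' ha hb S hS := S.mul_mem' (ha S hS) (hb S hS)
  add_mem' ha hb S hS := S.add_mem' (ha S hS) (hb S hS)
  algebraMap_mem' r S _ := S.algebraMap_mem' r
  pb_mem' ha hb S hS := S.pb_mem' (ha S hS) (hb S hS)

theorem PoissonSubalgebra.subset_adjoin (s : Set A) : s ⊆ (adjoin s).carrier :=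
  fun _ ha _ hS => hS ha

/-- The image of a Poisson morphism. -/
def PoissonHom.range (θ : PoissonHom A B) : PoissonSubalgebra B where
  toSubalgebra := θ.toAlgHom.range
  pb_mem' := by
    rintro _ _ ⟨a, rfl⟩ ⟨b, rfl⟩
    exact ⟨pb a b, θ.map_pb a b⟩

end PoissonBasics

/-! ### Poisson algebras presented by generators and relations -/

/-- Formal Poisson expressions in the generators `X`. -/
inductive PoissonTerm (X : Type*) where
  | of (x : X)
  | const (r : ℝ)
  | add (a b : PoissonTerm X)
  | mul (a b : PoissonTerm X)
  | bracket (a b : PoissonTerm X)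

namespace PoissonTerm

variable {X : Type*}

instance : Zero (PoissonTerm X) := ⟨const 0⟩
instance : One (PoissonTerm X) := ⟨const 1⟩
instance : Add (PoissonTerm X) := ⟨add⟩
instance : Mul (PoissonTerm X) := ⟨mul⟩
instance : Neg (PoissonTerm X) := ⟨fun a => const (-1) * a⟩
instance : Sub (PoissonTerm X) := ⟨fun a b => a + -b⟩

/-- The axioms of real Poisson algebras, the prescribed relations `rel`, and congruence. -/
inductive Rel (rel : PoissonTerm X → PoissonTerm X → Prop) :
    PoissonTerm X → PoissonTerm X → Prop where
  | of_rel {a b} : rel a b → Rel rel a b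
  | add_left {a a'} (b) : Rel rel a a' → Rel rel (a + b) (a' + b)
  | add_right (a) {b b'} : Rel rel b b' → Rel rel (a + b) (a + b')
  | mul_left {a a'} (b) : Rel rel a a' → Rel rel (a * b) (a' * b)
  | mul_right (a) {b b'} : Rel rel b b' → Rel rel (a * b) (a * b')
  | bracket_left {a a'} (b) : Rel rel a a' → Rel rel (bracket a b) (bracket a' b)
  | bracket_right (a) {b b'} : Rel rel b b' → Rel rel (bracket a b) (bracket a b')
  | add_assoc (a b c) : Rel rel (a + b + c) (a + (b + c))
  | add_comm (a b) : Rel rel (a + b) (b + a)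
  | zero_add (a) : Rel rel (0 + a) a
  | neg_add (a) : Rel rel (-a + a) 0
  | mul_assoc (a b c) : Rel rel (a * b * c) (a * (b * c))
  | mul_comm (a b) : Rel rel (a * b) (b * a)
  | one_mul (a) : Rel rel (1 * a) a
  | zero_mul (a) : Rel rel (0 * a) 0
  | mul_add (a b c) : Rel rel (a * (b + c)) (a * b + a * c)
  | const_add (r s) : Rel rel (const (r + s)) (const r + const s)
  | const_mul (r s) : Rel rel (const (r * s)) (const r * const s)
  | bracket_add_left (a b c) : Rel rel (bracket (a + b) c) (bracket a c + bracket b c)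
  | bracket_add_right (a b c) : Rel rel (bracket a (b + c)) (bracket a b + bracket a c)
  | bracket_const_left (r a b) : Rel rel (bracket (const r * a) b) (const r * bracket a b)
  | bracket_const_right (r a b) : Rel rel (bracket a (const r * b)) (const r * bracket a b)
  | bracket_self (a) : Rel rel (bracket a a) 0
  | jacobi (a b c) : Rel rel
      (bracket a (bracket b c) + bracket b (bracket c a) + bracket c (bracket a b)) 0
  | leibniz (a b c) : Rel rel (bracket a (b * c)) (bracket a b * c + b * bracket a c)

end PoissonTerm

/-- The real Poisson algebra with generators `X` and defining relations `rel`. -/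
def PresentedPoisson {X : Type*} (rel : PoissonTerm X → PoissonTerm X → Prop) : Type _ :=
  Quot (PoissonTerm.Rel rel)

namespace PresentedPoisson

open PoissonTerm (Rel)

variable {X : Type*} {rel : PoissonTerm X → PoissonTerm X → Prop}

/-- The element represented by an expression. -/
def mk (t : PoissonTerm X) : PresentedPoisson rel := Quot.mk _ t

instance : Zero (PresentedPoisson rel) := ⟨Quot.mk _ 0⟩
instance : One (PresentedPoisson rel) := ⟨Quot.mk _ 1⟩
instance : Add (PresentedPoisson rel) :=
  ⟨Quot.map₂ (· + ·) (fun a _ _ h => Rel.add_right a h) (fun _ _ b h => Rel.add_left b h)⟩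
instance : Mul (PresentedPoisson rel) :=
  ⟨Quot.map₂ (· * ·) (fun a _ _ h => Rel.mul_right a h) (fun _ _ b h => Rel.mul_left b h)⟩
instance : Neg (PresentedPoisson rel) :=
  ⟨Quot.map (fun a => -a) (fun _ _ h => Rel.mul_right _ h)⟩

instance : CommRing (PresentedPoisson rel) where
  add_assoc := by rintro ⟨a⟩ ⟨b⟩ ⟨c⟩; exact Quot.sound (Rel.add_assoc a b c)
  add_comm := by rintro ⟨a⟩ ⟨b⟩; exact Quot.sound (Rel.add_comm a b)
  zero_add := by rintro ⟨a⟩; exact Quot.sound (Rel.zero_add a)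
  add_zero := by
    rintro ⟨a⟩
    exact (Quot.sound (Rel.add_comm a 0)).trans (Quot.sound (Rel.zero_add a))
  neg_add_cancel := by rintro ⟨a⟩; exact Quot.sound (Rel.neg_add a)
  mul_assoc := by rintro ⟨a⟩ ⟨b⟩ ⟨c⟩; exact Quot.sound (Rel.mul_assoc a b c)
  mul_comm := by rintro ⟨a⟩ ⟨b⟩; exact Quot.sound (Rel.mul_comm a b)
  one_mul := by rintro ⟨a⟩; exact Quot.sound (Rel.one_mul a)
  mul_one := by
    rintro ⟨a⟩
    exact (Quot.sound (Rel.mul_comm a 1)).trans (Quot.sound (Rel.one_mul a))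
  left_distrib := by rintro ⟨a⟩ ⟨b⟩ ⟨c⟩; exact Quot.sound (Rel.mul_add a b c)
  right_distrib := by
    rintro ⟨a⟩ ⟨b⟩ ⟨c⟩
    exact (Quot.sound (Rel.mul_comm (a + b) c)).trans <|
      (Quot.sound (Rel.mul_add c a b)).trans <|
      (Quot.sound (Rel.add_left _ (Rel.mul_comm c a))).trans <|
      Quot.sound (Rel.add_right _ (Rel.mul_comm c b))
  zero_mul := by rintro ⟨a⟩; exact Quot.sound (Rel.zero_mul a)
  mul_zero := by
    rintro ⟨a⟩
    exact (Quot.sound (Rel.mul_comm a 0)).trans (Quot.sound (Rel.zero_mul a))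
  nsmul := nsmulRec
  zsmul := zsmulRec

/-- The structure map; the scalar `r` acts as multiplication by the constant `r`. -/
def constHom : ℝ →+* PresentedPoisson rel where
  toFun r := mk (PoissonTerm.const r)
  map_one' := rfl
  map_zero' := rfl
  map_add' r s := Quot.sound (Rel.const_add r s)
  map_mul' r s := Quot.sound (Rel.const_mul r s)

instance : Algebra ℝ (PresentedPoisson rel) := constHom.toAlgebra

instance : PoissonAlgebra (PresentedPoisson rel) where
  pb := LinearMap.mk₂ ℝ
    (Quot.map₂ PoissonTerm.bracket (fun a _ _ h => Rel.bracket_right a h)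
      (fun _ _ b h => Rel.bracket_left b h))
    (by rintro ⟨a⟩ ⟨b⟩ ⟨c⟩; exact Quot.sound (Rel.bracket_add_left a b c))
    (by rintro r ⟨a⟩ ⟨b⟩; exact Quot.sound (Rel.bracket_const_left r a b))
    (by rintro ⟨a⟩ ⟨b⟩ ⟨c⟩; exact Quot.sound (Rel.bracket_add_right a b c))
    (by rintro r ⟨a⟩ ⟨b⟩; exact Quot.sound (Rel.bracket_const_right r a b))
  pb_self := by rintro ⟨a⟩; exact Quot.sound (Rel.bracket_self a)
  pb_jacobi := by rintro ⟨a⟩ ⟨b⟩ ⟨c⟩; exact Quot.sound (Rel.jacobi a b c)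
  pb_mul := by rintro ⟨a⟩ ⟨b⟩ ⟨c⟩; exact Quot.sound (Rel.leibniz a b c)

end PresentedPoisson

/-! ### The Poisson analog of the Racah algebra `R(n)` -/

/-- Generators of `R(n)`: the one-index `C i` and the two-index `P i j`; the index `i : Fin n`
stands for the site `i + 1` of the chain. -/
inductive RacahGen (n : ℕ) where
  | C (i : Fin n)
  | P (i j : Fin n)

namespace RacahTerm

open PoissonTerm

variable {n : ℕ}

/-- The expression `C_i`. -/
def C (i : Fin n) : PoissonTerm (RacahGen n) := of (.C i)

/-- The expression `P_ij`. -/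
def P (i j : Fin n) : PoissonTerm (RacahGen n) := of (.P i j)

/-- The expression `F_ijk = ½ {P_ij, P_jk}`. -/
def F (i j k : Fin n) : PoissonTerm (RacahGen n) := const (1 / 2) * bracket (P i j) (P j k)

/-- Pairwise distinct indices are expressed by `List.Nodup`. The generators are `P_ij = P_ji`
with `i ≠ j`; the symbols `P_ii` are set to zero. -/
inductive Rel (n : ℕ) : PoissonTerm (RacahGen n) → PoissonTerm (RacahGen n) → Prop where
  | P_symm (i j) : Rel n (P i j) (P j i)
  | P_diag (i) : Rel n (P i i) 0
  | C_C (i j) : Rel n (bracket (C i) (C j)) 0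
  | C_P (i j k) : Rel n (bracket (C i) (P j k)) 0
  | P_P (i j k l) : [i, j, k, l].Nodup → Rel n (bracket (P i j) (P k l)) 0
  | F_swap_left (i j k) : [i, j, k].Nodup → Rel n (F i j k) (-F j i k)
  | F_swap_right (i j k) : [i, j, k].Nodup → Rel n (F i j k) (-F i k j)
  | P_F (i j k) : [i, j, k].Nodup → Rel n (bracket (P j k) (F i j k))
      (P i k * P j k - P j k * P i j + const 2 * P i k * C j - const 2 * P i j * C k)
  | P_F' (i j k l) : [i, j, k, l].Nodup → Rel n (bracket (P k l) (F i j k))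
      (P i k * P j l - P i l * P j k)
  | F_F (i j k l) : [i, j, k, l].Nodup → Rel n (bracket (F i j k) (F j k l))
      (F j k l * P i j - F i k l * (P j k + const 2 * C j) - F i j k * P j l)
  | F_F' (i j k l m) : [i, j, k, l, m].Nodup → Rel n (bracket (F i j k) (F k l m))
      (F i l m * P j k - P i k * F j l m)

end RacahTerm

/-- The Poisson analog of the Racah algebra `R(n)`. -/
abbrev Racah (n : ℕ) : Type := PresentedPoisson (RacahTerm.Rel n)

namespace Racah

variable {n : ℕ}

/-- The one-index generator `C_i`. -/
def C (i : Fin n) : Racah n := PresentedPoisson.mk (RacahTerm.C i)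

/-- The generator `P_ij = C_ij - C_i - C_j`. -/
def P (i j : Fin n) : Racah n := PresentedPoisson.mk (RacahTerm.P i j)

/-- `C_A = ∑_{i < j in A} P_ij + ∑_{i in A} C_i`; for a pair this is `C_ij`. -/
def cas (A : Finset (Fin n)) : Racah n :=
  (∑ i ∈ A, ∑ j ∈ A with i < j, P i j) + ∑ i ∈ A, C i

/-- `L_m = C_{1…m}` in `R(n)`. -/
def left (n m : ℕ) : Racah n := cas {i | i.val + 1 ≤ m}

/-- `R_m = C_{m…n}` in `R(n)`. -/
def right (n m : ℕ) : Racah n := cas {i | m ≤ i.val + 1}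

end Racah

/-! ### The Poisson coalgebra `sl(2, ℝ)` -/

/-- The generators `J₊, J₋, J₃`. -/
inductive SL2Gen where
  | plus | minus | three
  deriving DecidableEq

instance : Fintype SL2Gen :=
  ⟨{.plus, .minus, .three}, fun σ => by cases σ <;> decide⟩

/-- The `n`-fold tensor power of the Lie-Poisson algebra `𝔄 = ℝ[J₊, J₋, J₃]`, i.e. the polynomial
algebra in the generators `J_σ^(i)` attached to the `n` sites; `𝔄` itself is `Chain 1`. -/
abbrev Chain (n : ℕ) : Type := MvPolynomial (Fin n × SL2Gen) ℝ

namespace Chain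

open MvPolynomial SL2Gen

variable {n : ℕ}

/-- The generator `J_σ` at site `i`. -/
def J (i : Fin n) (σ : SL2Gen) : Chain n := X (i, σ)

/-- `{J_σ, J_τ}` at site `i`: `{J₋, J₊} = 2 J₃` and `{J₃, J_±} = ± J_±`. -/
def genBracket (i : Fin n) : SL2Gen → SL2Gen → Chain n
  | minus, plus => (2 : ℝ) • J i three
  | plus, minus => -((2 : ℝ) • J i three)
  | three, plus => J i plus
  | plus, three => -J i plus
  | three, minus => -J i minus
  | minus, three => J i minus
  | plus, plus => 0
  | minus, minus => 0
  | three, three => 0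

/-- The derivation `{f, ·}` of the tensor power: generators at different sites commute. -/
def ham (f : Chain n) : Derivation ℝ (Chain n) (Chain n) :=
  ∑ i, ∑ σ, ∑ τ, (pderiv (i, σ) f * genBracket i σ τ) • pderiv (i, τ)

theorem ham_apply (f g : Chain n) : ham f g =
    ∑ i, ∑ σ, ∑ τ, pderiv (i, σ) f * genBracket i σ τ * pderiv (i, τ) g := by
  have key : ∀ {ι : Type} (s : Finset ι) (D : ι → Derivation ℝ (Chain n) (Chain n)),
      (∑ i ∈ s, D i) g = ∑ i ∈ s, D i g := fun s D => by
    classical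
    induction s using Finset.induction_on with
    | empty => simp
    | insert a s ha ih => rw [Finset.sum_insert ha, Finset.sum_insert ha, Derivation.add_apply, ih]
  simp only [ham, key, Derivation.smul_apply, smul_eq_mul]

theorem genBracket_anti (i : Fin n) (σ τ : SL2Gen) :
    genBracket i σ τ = -genBracket i τ σ := by
  cases σ <;> cases τ <;> simp [genBracket]

theorem ham_anti (f g : Chain n) : ham f g = -ham g f := by
  simp only [ham_apply, ← Finset.sum_neg_distrib]
  refine Finset.sum_congr rfl fun i _ => ?_
  rw [Finset.sum_comm]
  refine Finset.sum_congr rfl fun σ _ => Finset.sum_congr rfl fun τ _ => ?_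
  rw [genBracket_anti]; ring

theorem ham_add (f g : Chain n) : ham (f + g) = ham f + ham g := by
  ext v
  simp [ham_apply, add_mul, Finset.sum_add_distrib]

theorem ham_smul (r : ℝ) (f : Chain n) : ham (r • f) = r • ham f := by
  ext1 v
  rw [Derivation.smul_apply]
  simp only [ham_apply, Finset.smul_sum, Derivation.map_smul, smul_mul_assoc]

theorem ham_neg (f : Chain n) : ham (-f) = -ham f := by
  ext1 v
  rw [← neg_one_smul ℝ f, ham_smul, Derivation.smul_apply, neg_one_smul, Derivation.neg_apply]

theorem ham_zero : ham (0 : Chain n) = 0 := by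
  have := ham_smul 0 (0 : Chain n)
  simpa only [zero_smul] using this

theorem ham_X (i j : Fin n) (σ τ : SL2Gen) :
    ham (X (i, σ)) (X (j, τ) : Chain n) = if i = j then genBracket i σ τ else 0 := by
  classical
  rw [ham_apply]
  simp only [pderiv_X, Pi.single_apply, Prod.mk.injEq]
  rw [Finset.sum_eq_single i, Finset.sum_eq_single σ, Finset.sum_eq_single τ]
  all_goals simp +contextual [eq_comm]

theorem ham_jacobi_ext (f g : Chain n)
    (h : ∀ v, ham (ham f g) (X v) = ham f (ham g (X v)) - ham g (ham f (X v))) (p : Chain n) :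
    ham (ham f g) p = ham f (ham g p) - ham g (ham f p) := by
  have : ham (ham f g) = ⁅ham f, ham g⁆ := by
    ext1 v; rw [Derivation.commutator_apply]; exact h v
  rw [this, Derivation.commutator_apply]

theorem ham_jacobi_X (i j l : Fin n) (σ τ ρ : SL2Gen) :
    ham (ham (X (i, σ)) (X (j, τ))) (X (l, ρ) : Chain n) =
      ham (X (i, σ)) (ham (X (j, τ)) (X (l, ρ))) - ham (X (j, τ)) (ham (X (i, σ)) (X (l, ρ))) := by
  by_cases hij : i = j <;> by_cases hil : i = l <;> by_cases hjl : j = l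
  all_goals
    try subst hij
    try subst hil
    try subst hjl
    cases σ <;> cases τ <;> cases ρ <;>
    simp_all [ham_X, genBracket, J, ham_smul, ham_neg, ham_zero, eq_comm]

theorem ham_jacobi (f g h : Chain n) :
    ham (ham f g) h = ham f (ham g h) - ham g (ham f h) := by
  have h1 : ∀ u v, ∀ p : Chain n,
      ham (ham (X u) (X v)) p = ham (X u) (ham (X v) p) - ham (X v) (ham (X u) p) :=
    fun u v => ham_jacobi_ext _ _ fun w => ham_jacobi_X _ _ _ _ _ _
  have h2 : ∀ u, ∀ p q : Chain n,
      ham (ham (X u) p) q = ham (X u) (ham p q) - ham p (ham (X u) q) := by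
    intro u p
    refine ham_jacobi_ext _ _ fun v => ?_
    have := h1 u v p
    rw [ham_anti (ham (X u) p), ham_anti p (X v), map_neg, ham_anti p (ham _ _), this]
    ring
  refine ham_jacobi_ext _ _ (fun v => ?_) h
  have := h2 v f g
  rw [ham_anti (ham f g) (X v), ham_anti g (X v), ham_anti f (X v), map_neg, map_neg,
    ham_anti g (ham (X v) f), this]
  ring

/-- The standard Poisson structure on the tensor power. -/
instance : PoissonAlgebra (Chain n) where
  pb := LinearMap.mk₂ ℝ (fun f g => ham f g)
    (fun f g h => by rw [ham_add, Derivation.add_apply])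
    (fun r f g => by rw [ham_smul, Derivation.smul_apply])
    (fun f g h => map_add _ _ _) (fun r f g => Derivation.map_smul _ _ _)
  pb_self f := by
    have h := ham_anti f f
    exact self_eq_neg.mp h
  pb_jacobi f g h := by
    change ham f (ham g h) + ham g (ham h f) + ham h (ham f g) = 0
    rw [ham_anti h (ham f g), ham_jacobi, ham_anti h f, map_neg]
    ring
  pb_mul f g h := by
    change ham f (g * h) = ham f g * h + g * ham f h
    rw [Derivation.leibniz, smul_eq_mul, smul_eq_mul]
    ring

/-- The value of the Casimir function `C(J₊, J₋, J₃) = J₃² - J₊ J₋`. -/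
def casimirFun (j : SL2Gen → Chain n) : Chain n := j three ^ 2 - j plus * j minus

/-- The Casimir `C` in `𝔄`. -/
def casimir : Chain 1 := casimirFun (J 0)

/-- The Casimir `C_i` of the `i`-th site. -/
def siteCas (i : Fin n) : Chain n := casimirFun (J i)

/-- The Casimir `C_A` of the sites in `A`: the Casimir function evaluated at
`∑_{i in A} J_σ^(i)`. -/
def cas (A : Finset (Fin n)) : Chain n := casimirFun fun σ => ∑ i ∈ A, J i σ

/-- `id ⊗ ⋯ ⊗ id ⊗ Δ`, with the primitive coproduct `Δ(J_σ) = J_σ ⊗ 1 + 1 ⊗ J_σ`. -/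
def coprodLast (m : ℕ) : Chain (m + 1) →ₐ[ℝ] Chain (m + 2) :=
  aeval fun v => if v.1 = Fin.last m
    then J (Fin.last m).castSucc v.2 + J (Fin.last (m + 1)) v.2
    else J v.1.castSucc v.2

/-- `Δ ⊗ id ⊗ ⋯ ⊗ id`. -/
def coprodFirst (m : ℕ) : Chain (m + 1) →ₐ[ℝ] Chain (m + 2) :=
  aeval fun v => if v.1 = 0 then J 0 v.2 + J 1 v.2 else J v.1.succ v.2

/-- The left iterated coproduct `Δ_L^[m+1]`. -/
def coprodL : (m : ℕ) → Chain 1 →ₐ[ℝ] Chain (m + 1)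
  | 0 => AlgHom.id ℝ _
  | m + 1 => (coprodLast m).comp (coprodL m)

/-- The right iterated coproduct `Δ_R^[m+1]`. -/
def coprodR : (m : ℕ) → Chain 1 →ₐ[ℝ] Chain (m + 1)
  | 0 => AlgHom.id ℝ _
  | m + 1 => (coprodFirst m).comp (coprodR m)

/-- The left Casimir `C^[m]`, on the sites `1, …, m` of the chain (for `1 ≤ m ≤ n`). -/
def upperCas (n m : ℕ) : Chain n :=
  if h : 1 ≤ m ∧ m ≤ n then
    rename (fun v : Fin (m - 1 + 1) × SL2Gen => ((⟨v.1.val, by omega⟩ : Fin n), v.2))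
      (coprodL (m - 1) casimir)
  else 0

/-- The right Casimir `C_[m]`, on the sites `n - m + 1, …, n` of the chain
(for `1 ≤ m ≤ n`). -/
def lowerCas (n m : ℕ) : Chain n :=
  if h : 1 ≤ m ∧ m ≤ n then
    rename (fun v : Fin (m - 1 + 1) × SL2Gen => ((⟨n - m + v.1.val, by omega⟩ : Fin n), v.2))
      (coprodR (m - 1) casimir)
  else 0

/-- `L_m = C^[m]`. -/
def left (n m : ℕ) : Chain n := upperCas n m

/-- `R_m = C_[n-m+1]`. -/
def right (n m : ℕ) : Chain n := lowerCas n (n + 1 - m)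

/-- The Poisson algebra `R(n)` realised in the coalgebra: the Poisson subalgebra of the `n`-fold
tensor power generated by the Casimirs `C_A`. -/
def racah (n : ℕ) : PoissonSubalgebra (Chain n) :=
  PoissonSubalgebra.adjoin (Set.range fun A : Finset (Fin n) => cas A)

/-- `C_A` as an element of the realised `R(n)`. -/
def racahCas (A : Finset (Fin n)) : (racah n).toSubalgebra :=
  ⟨cas A, PoissonSubalgebra.subset_adjoin _ ⟨A, rfl⟩⟩

end Chain

/-! ### The substructures and the embeddings -/

/-- The blocks `K₁ = {1, …, k-1}`, `K₂ = {k}`, `K₃ = {k+1, …, n}` of sites. -/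
def siteBlock (n k : ℕ) : Fin 3 → Finset (Fin n) :=
  ![({i | i.val + 1 < k} : Finset (Fin n)), ({i | i.val + 1 = k} : Finset (Fin n)),
    ({i | k < i.val + 1} : Finset (Fin n))]

section Substructure

variable {X Y : Type*} [CommRing X] [Algebra ℝ X] [PoissonAlgebra X]
  [CommRing Y] [Algebra ℝ Y] [PoissonAlgebra Y]

/-- `M_k = L_n - L_k - R_k + L_{k-1} + C_k + R_{k+1}`. -/
def midCas (n k : ℕ) (L R : ℕ → Y) (Ck : Y) : Y :=
  L n - L k - R k + L (k - 1) + Ck + R (k + 1)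

/-- `F_k = ½ {L_k, R_k}`. -/
def bracketCas (k : ℕ) (L R : ℕ → Y) : Y := (1 / 2 : ℝ) • pb (L k) (R k)

/-- The substructure `S_(n,k)`: the Poisson subalgebra generated by the left and right Casimirs
`L_{k-1}, L_k, R_k, R_{k+1}`, the total Casimir `L_n` and the one-site Casimir `C_k`. -/
def substructure (n k : ℕ) (L R : ℕ → Y) (Ck : Y) : PoissonSubalgebra Y :=
  PoissonSubalgebra.adjoin {L (k - 1), Ck, R (k + 1), L k, R k, L n}

/-- The quadratic Poisson relations of `S_(n,k)`, in both presentations (with and without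
`M_k`). -/
structure QuadraticRelations (n k : ℕ) (L R : ℕ → Y) (Ck : Y) : Prop where
  central : ∀ z ∈ ({L (k - 1), Ck, R (k + 1), L n} : Set Y),
    ∀ y ∈ (substructure n k L R Ck).toSubalgebra, pb z y = 0
  F_eq_RM : bracketCas k L R = (1 / 2 : ℝ) • pb (R k) (midCas n k L R Ck)
  F_eq_ML : bracketCas k L R = (1 / 2 : ℝ) • pb (midCas n k L R Ck) (L k)
  L_F : pb (L k) (bracketCas k L R) =
    R k * L k - L k * midCas n k L R Ck + (Ck - L (k - 1)) * (R (k + 1) - L n)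
  R_F : pb (R k) (bracketCas k L R) =
    midCas n k L R Ck * R k - R k * L k + (R (k + 1) - Ck) * (L (k - 1) - L n)
  M_F : pb (midCas n k L R Ck) (bracketCas k L R) =
    L k * midCas n k L R Ck - midCas n k L R Ck * R k + (L (k - 1) - R (k + 1)) * (Ck - L n)
  L_F' : pb (L k) (bracketCas k L R) =
    L k ^ 2 + 2 * R k * L k - (L n + L (k - 1) + Ck + R (k + 1)) * L k
      + (Ck - L (k - 1)) * (R (k + 1) - L n)
  R_F' : pb (R k) (bracketCas k L R) =
    -R k ^ 2 - 2 * L k * R k + (L n + L (k - 1) + Ck + R (k + 1)) * R k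
      + (R (k + 1) - Ck) * (L (k - 1) - L n)

/-- `θ` is the injective morphism `C_B ↦ C_{K_B}`, where `c B` are the Casimirs of `R(3)` and
`C A`, `L`, `R`, `Ck` those of `R(n)`; it is determined by its values, its image is generated by
the seven listed Casimirs, coincides with `S_(n,k)`, and `S_(n,k)` is isomorphic to `R(3)`. -/
structure IsRacahEmbedding (n k : ℕ) (c : Finset (Fin 3) → X) (C : Finset (Fin n) → Y)
    (L R : ℕ → Y) (Ck : Y) (θ : PoissonHom X Y) : Prop where
  map_cas : ∀ B, θ (c B) = C (B.biUnion (siteBlock n k))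
  unique : ∀ θ' : PoissonHom X Y,
    (∀ B, θ' (c B) = C (B.biUnion (siteBlock n k))) → θ' = θ
  injective : Function.Injective θ
  map_one : θ (c {0}) = L (k - 1)
  map_two : θ (c {1}) = Ck
  map_three : θ (c {2}) = R (k + 1)
  map_one_two : θ (c {0, 1}) = L k
  map_two_three : θ (c {1, 2}) = R k
  map_one_three : θ (c {0, 2}) = midCas n k L R Ck
  map_one_two_three : θ (c {0, 1, 2}) = L n
  total : L n = R 1
  range_eq : θ.range = PoissonSubalgebra.adjoin
    {L (k - 1), Ck, R (k + 1), L k, R k, midCas n k L R Ck, L n}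
  range_eq_substructure : θ.range = substructure n k L R Ck
  relations : QuadraticRelations n k L R Ck
  iso : Nonempty (PoissonEquiv (substructure n k L R Ck).toSubalgebra X)

end Substructure

end

noncomputable section

open PoissonAlgebra (pb pb_mul pb_self pb_jacobi)

/-! ### Poisson brackets -/

/-! The embedding merges the sites of each block: `C q` goes to the Casimir of `K q`, and `P q r` to
the sum of `P i j` over `i ∈ K q`, `j ∈ K r`. By the universal property of the presentation only the
relations of `R(3)` need checking, and with three indices those in four or five distinct letters are
vacuous. Centrality and antisymmetry pass to block sums termwise, up to cancellations `{P_ij, P_ik +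
P_jk} = 0`. The one quadratic relation left is `pb_blockP_blockF`: collecting `P i j` and `2 C_i`
into a single Gram matrix makes all its terms instances of one formula, and summing the matrix over
a block gives twice its Casimir.

Injectivity (`Racah.merge_injective`) comes from a left inverse: choose one site per block and send
the generators of all other sites to zero. This respects the relations of `R(n)` because every
monomial in a relation involves every index of that relation.

In the coalgebra, `P i j` is realised by the polarisation `dot i j` of the Casimir and `F i j k` by
the trilinear form `det i j k`; the relations become polynomial identities, and `C_A` goes to `C_A`
because the Casimir is quadratic. Merging is the substitution of `J_σ` at `q` by the block sum of
`J_σ`, again split by a choice of sites.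

The remaining assertions concern only the morphism from `R(3)`. Its image is generated by the images
of the Casimirs, among which the one for sites 1 and 3 is a linear combination of the others; the
quadratic relations are images of relations in `R(3)`. Thus `isRacahEmbedding_of_map_cas` treats
both settings, with the identity or the realisation of `R(3)` as the surjection. -/

theorem half_smul_two_mul {A : Type*} [CommRing A] [Algebra ℝ A] (a : A) :
    (1 / 2 : ℝ) • (2 * a) = a := by
  rw [two_mul, ← two_smul ℝ a, smul_smul]; norm_num

theorem two_mul_half_smul {A : Type*} [CommRing A] [Algebra ℝ A] (a : A) :
    2 * ((1 / 2 : ℝ) • a) = a := by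
  rw [mul_smul_comm, half_smul_two_mul]

/-- Lets identities for Casimirs be proved after doubling, where a Casimir is a symmetric double sum
without the order condition `i < j`. -/
theorem eq_of_two_mul_eq {A : Type*} [CommRing A] [Algebra ℝ A] {a b : A}
    (h : 2 * a = 2 * b) : a = b := by
  rw [← half_smul_two_mul a, h, half_smul_two_mul]

section PoissonLemmas

variable {A B D : Type*} [CommRing A] [Algebra ℝ A] [PoissonAlgebra A]
  [CommRing B] [Algebra ℝ B] [PoissonAlgebra B] [CommRing D] [Algebra ℝ D] [PoissonAlgebra D]

theorem pb_anti (a b : A) : pb a b = -pb b a := by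
  have h := pb_self (a + b)
  simp only [map_add, LinearMap.add_apply, pb_self] at h
  linear_combination h

theorem pb_mul_left (a b c : A) : pb (a * b) c = pb a c * b + a * pb b c := by
  rw [pb_anti, pb_mul, pb_anti c a, pb_anti c b]; ring

theorem pb_one (a : A) : pb a 1 = 0 := by
  have h := pb_mul a 1 1
  simp only [mul_one, one_mul] at h
  linear_combination -h

theorem pb_algebraMap (a : A) (r : ℝ) : pb a (algebraMap ℝ A r) = 0 := by
  rw [Algebra.algebraMap_eq_smul_one, map_smul, pb_one, smul_zero]

/-- Jacobi's identity: `pb a` is a derivation of the bracket. -/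
theorem pb_pb (a b c : A) : pb a (pb b c) = pb (pb a b) c + pb b (pb a c) := by
  have h := pb_jacobi a b c
  rw [pb_anti c a, map_neg, pb_anti c (pb a b)] at h
  linear_combination h

/-- The elements commuting with `z`. -/
def PoissonSubalgebra.commutant (z : A) : PoissonSubalgebra A where
  carrier := {a | pb z a = 0}
  mul_mem' {a b} ha hb := by
    simp only [Set.mem_ofPred_eq] at *
    rw [pb_mul, ha, hb]; ring
  add_mem' {a b} ha hb := by
    simp only [Set.mem_ofPred_eq] at *
    rw [map_add, ha, hb, add_zero]
  algebraMap_mem' r := pb_algebraMap z r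
  pb_mem' {a b} ha hb := by
    simp only [Set.mem_ofPred_eq] at *
    rw [pb_pb, ha, hb]; simp

/-- The elements on which two Poisson morphisms agree. -/
def PoissonHom.equalizer (φ ψ : PoissonHom A B) : PoissonSubalgebra A where
  toSubalgebra := AlgHom.equalizer φ.toAlgHom ψ.toAlgHom
  pb_mem' {a b} (ha : φ a = ψ a) (hb : φ b = ψ b) := by
    change φ (pb a b) = ψ (pb a b)
    rw [φ.map_pb, ψ.map_pb, ha, hb]

theorem PoissonHom.ext {φ ψ : PoissonHom A B} (h : ∀ a, φ a = ψ a) : φ = ψ := by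
  obtain ⟨φ', _⟩ := φ
  obtain ⟨ψ', _⟩ := ψ
  obtain rfl : φ' = ψ' := AlgHom.ext h
  rfl

/-- Composition of Poisson morphisms. -/
def PoissonHom.comp (φ : PoissonHom B D) (ψ : PoissonHom A B) : PoissonHom A D where
  toAlgHom := φ.toAlgHom.comp ψ.toAlgHom
  map_pb' a b := (congrArg φ (ψ.map_pb a b)).trans (φ.map_pb _ _)

@[simp]
theorem PoissonHom.comp_apply (φ : PoissonHom B D) (ψ : PoissonHom A B) (a : A) :
    φ.comp ψ a = φ (ψ a) := rfl

/-- The identity morphism. -/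
def PoissonHom.id (A : Type*) [CommRing A] [Algebra ℝ A] [PoissonAlgebra A] :
    PoissonHom A A where
  toAlgHom := AlgHom.id ℝ A
  map_pb' _ _ := rfl

/-- The inverse image of a Poisson subalgebra. -/
def PoissonSubalgebra.comap (φ : PoissonHom A B) (S : PoissonSubalgebra B) :
    PoissonSubalgebra A where
  toSubalgebra := S.toSubalgebra.comap φ.toAlgHom
  pb_mem' {a b} (ha : φ a ∈ S.carrier) (hb : φ b ∈ S.carrier) := by
    change φ (pb a b) ∈ S.carrier
    rw [φ.map_pb]
    exact S.pb_mem' ha hb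

/-- The inclusion of a Poisson subalgebra. -/
def PoissonSubalgebra.subtype (S : PoissonSubalgebra A) : PoissonHom S.toSubalgebra A where
  toAlgHom := S.toSubalgebra.val
  map_pb' _ _ := rfl

/-- Restriction of the codomain of a Poisson morphism. -/
def PoissonHom.codRestrict (φ : PoissonHom A B) (S : PoissonSubalgebra B)
    (h : ∀ a, φ a ∈ S.toSubalgebra) : PoissonHom A S.toSubalgebra where
  toAlgHom := φ.toAlgHom.codRestrict S.toSubalgebra h
  map_pb' a b := Subtype.ext (φ.map_pb a b)

theorem PoissonSubalgebra.ext_carrier {S T : PoissonSubalgebra A} (h : S.carrier = T.carrier) :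
    S = T := by
  obtain ⟨S', _⟩ := S
  obtain ⟨T', _⟩ := T
  obtain rfl : S' = T' := SetLike.coe_injective h
  rfl

theorem PoissonSubalgebra.adjoin_subset {s : Set A} {S : PoissonSubalgebra A}
    (h : s ⊆ S.carrier) : (adjoin s).carrier ⊆ S.carrier :=
  fun _ ha => ha S h

theorem PoissonSubalgebra.add_mem {S : PoissonSubalgebra A} {a b : A} (ha : a ∈ S.carrier)
    (hb : b ∈ S.carrier) : a + b ∈ S.carrier := S.toSubalgebra.add_mem ha hb

theorem PoissonSubalgebra.sub_mem {S : PoissonSubalgebra A} {a b : A} (ha : a ∈ S.carrier)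
    (hb : b ∈ S.carrier) : a - b ∈ S.carrier := S.toSubalgebra.sub_mem ha hb

theorem PoissonSubalgebra.zero_mem (S : PoissonSubalgebra A) : (0 : A) ∈ S.carrier :=
  S.toSubalgebra.zero_mem

/-- If the set `s` generates `A`, the image of a morphism is generated by the image of `s`. -/
theorem PoissonHom.range_eq_adjoin (φ : PoissonHom A B) {s : Set A}
    (hs : ∀ a, a ∈ (PoissonSubalgebra.adjoin s).carrier) :
    φ.range = PoissonSubalgebra.adjoin (φ '' s) := by
  refine PoissonSubalgebra.ext_carrier (Set.Subset.antisymm ?_ ?_)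
  · rintro _ ⟨a, rfl⟩
    refine hs a (PoissonSubalgebra.comap φ (PoissonSubalgebra.adjoin (φ '' s))) ?_
    exact fun x hx => PoissonSubalgebra.subset_adjoin _ ⟨x, hx, rfl⟩
  · refine PoissonSubalgebra.adjoin_subset ?_
    rintro _ ⟨x, -, rfl⟩
    exact ⟨x, rfl⟩

theorem PoissonSubalgebra.adjoin_eq_adjoin {s t : Set A} (hst : s ⊆ (adjoin t).carrier)
    (hts : t ⊆ (adjoin s).carrier) : adjoin s = adjoin t :=
  ext_carrier (Set.Subset.antisymm (adjoin_subset hst) (adjoin_subset hts))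

/-- An injective morphism is an isomorphism onto its image. -/
theorem PoissonHom.nonempty_equiv_range (φ : PoissonHom A B) (hφ : Function.Injective φ)
    {S : PoissonSubalgebra B} (hS : φ.range = S) : Nonempty (PoissonEquiv S.toSubalgebra A) := by
  subst hS
  let e : A ≃ₐ[ℝ] φ.range.toSubalgebra := AlgEquiv.ofInjective φ.toAlgHom hφ
  refine ⟨⟨e.symm, fun x y => ?_⟩⟩
  change e.symm (pb x y) = pb (e.symm x) (e.symm y)
  rw [AlgEquiv.symm_apply_eq]
  refine Subtype.ext ?_
  have he : ∀ a, ((e a : φ.range.toSubalgebra) : B) = φ a := fun _ => rfl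
  rw [he, φ.map_pb, ← he, ← he, e.apply_symm_apply, e.apply_symm_apply]
  rfl

end PoissonLemmas

/-! ### The universal property of a presented Poisson algebra -/

namespace PoissonTerm

variable {X A : Type*} [CommRing A] [Algebra ℝ A] [PoissonAlgebra A]

/-- The value of an expression in a Poisson algebra. -/
def eval (f : X → A) : PoissonTerm X → A
  | of x => f x
  | const r => algebraMap ℝ A r
  | add a b => eval f a + eval f b
  | mul a b => eval f a * eval f b
  | bracket a b => pb (eval f a) (eval f b)

variable (f : X → A) (a b : PoissonTerm X)

@[simp] theorem eval_of (x : X) : eval f (of x) = f x := rfl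
@[simp] theorem eval_const (r : ℝ) : eval f (const r) = algebraMap ℝ A r := rfl
@[simp] theorem eval_add : eval f (a + b) = eval f a + eval f b := rfl
@[simp] theorem eval_mul : eval f (a * b) = eval f a * eval f b := rfl
@[simp] theorem eval_bracket : eval f (bracket a b) = pb (eval f a) (eval f b) := rfl
@[simp] theorem eval_zero : eval f 0 = 0 := map_zero (algebraMap ℝ A)
@[simp] theorem eval_one : eval f 1 = 1 := map_one (algebraMap ℝ A)

@[simp]
theorem eval_neg : eval f (-a) = -eval f a := by
  change algebraMap ℝ A (-1) * eval f a = _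
  simp

@[simp]
theorem eval_sub : eval f (a - b) = eval f a - eval f b := by
  change eval f (a + -b) = _
  rw [eval_add, eval_neg, sub_eq_add_neg]

variable {f}

/-- Apart from `rel`, every clause of the congruence is a law valid in any Poisson algebra. -/
theorem eval_eq_of_rel {rel : PoissonTerm X → PoissonTerm X → Prop}
    (h : ∀ a b, rel a b → eval f a = eval f b) {a b : PoissonTerm X} (hab : Rel rel a b) :
    eval f a = eval f b := by
  induction hab with
  | of_rel hr => exact h _ _ hr
  | bracket_const_left r a b =>
    simp only [eval_bracket, eval_mul, eval_const, ← Algebra.smul_def, map_smul,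
      LinearMap.smul_apply]
  | bracket_const_right r a b =>
    simp only [eval_bracket, eval_mul, eval_const, ← Algebra.smul_def, map_smul]
  | bracket_self a => simpa using pb_self _
  | jacobi a b c => simpa using pb_jacobi _ _ _
  | leibniz a b c => simpa using pb_mul _ _ _
  | add_left _ _ ih => simp [ih]
  | add_right _ _ ih => simp [ih]
  | mul_left _ _ ih => simp [ih]
  | mul_right _ _ ih => simp [ih]
  | bracket_left _ _ ih => simp [ih]
  | bracket_right _ _ ih => simp [ih]
  | _ => simp <;> ring

end PoissonTerm

namespace PresentedPoisson

open PoissonTerm (eval)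

variable {X A : Type*} {rel : PoissonTerm X → PoissonTerm X → Prop}
  [CommRing A] [Algebra ℝ A] [PoissonAlgebra A]

/-- The morphism determined by images of the generators that satisfy the relations. -/
def lift (f : X → A) (h : ∀ a b, rel a b → eval f a = eval f b) :
    PoissonHom (PresentedPoisson rel) A where
  toFun := Quot.lift (eval f) fun _ _ hab => PoissonTerm.eval_eq_of_rel h hab
  map_one' := PoissonTerm.eval_one f
  map_zero' := PoissonTerm.eval_zero f
  map_mul' := by rintro ⟨a⟩ ⟨b⟩; rfl
  map_add' := by rintro ⟨a⟩ ⟨b⟩; rfl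
  commutes' _ := rfl
  map_pb' := by rintro ⟨a⟩ ⟨b⟩; rfl

theorem mk_eq_eval (t : PoissonTerm X) :
    (mk t : PresentedPoisson rel) = eval (fun x => mk (.of x)) t := by
  induction t with
  | of x => rfl
  | const r => rfl
  | add a b iha ihb => exact congrArg₂ (· + ·) iha ihb
  | mul a b iha ihb => exact congrArg₂ (· * ·) iha ihb
  | bracket a b iha ihb =>
    exact congrArg₂ (fun x y : PresentedPoisson rel => pb x y) iha ihb

theorem eval_of_rel {a b : PoissonTerm X} (h : rel a b) :
    eval (fun x => (mk (.of x) : PresentedPoisson rel)) a = eval (fun x => mk (.of x)) b := by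
  rw [← mk_eq_eval, ← mk_eq_eval]
  exact Quot.sound (.of_rel h)

/-- Induction on generators: applied to a commutant it yields centrality, applied to an equalizer it
yields uniqueness of morphisms. -/
theorem mem_of_forall_gen (S : PoissonSubalgebra (PresentedPoisson rel))
    (h : ∀ x, mk (.of x) ∈ S.carrier) (a : PresentedPoisson rel) : a ∈ S.carrier := by
  obtain ⟨t⟩ := a
  change mk t ∈ _
  induction t with
  | of x => exact h x
  | const r => exact S.algebraMap_mem' r
  | add a b iha ihb => exact S.add_mem' iha ihb
  | mul a b iha ihb => exact S.mul_mem' iha ihb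
  | bracket a b iha ihb => exact S.pb_mem' iha ihb

end PresentedPoisson

/-! ### Brackets in `R(n)` -/

namespace Racah

open PoissonTerm (eval)

variable {n : ℕ}

/-- `F_ijk = ½ {P_ij, P_jk}`. -/
def F (i j k : Fin n) : Racah n := (1 / 2 : ℝ) • pb (P i j) (P j k)

theorem eval_rel {a b : PoissonTerm (RacahGen n)} (h : RacahTerm.Rel n a b) :
    eval (fun x => (PresentedPoisson.mk (.of x) : Racah n)) a =
      eval (fun x => PresentedPoisson.mk (.of x)) b :=
  PresentedPoisson.eval_of_rel h

section EvalGen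

variable (i j k : Fin n)

theorem eval_gen_C : eval (fun x => (PresentedPoisson.mk (.of x) : Racah n)) (RacahTerm.C i) =
    C i := rfl

theorem eval_gen_P : eval (fun x => (PresentedPoisson.mk (.of x) : Racah n)) (RacahTerm.P i j) =
    P i j := rfl

theorem eval_gen_F : eval (fun x => (PresentedPoisson.mk (.of x) : Racah n))
    (RacahTerm.F i j k) = F i j k :=
  (Algebra.smul_def (1 / 2 : ℝ) (pb (P i j) (P j k))).symm

end EvalGen

/-! ### The defining relations as identities in `R(n)`. -/

section Relations

variable (i j k l m : Fin n)

theorem P_symm : P i j = P j i := eval_rel (.P_symm i j)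

@[simp]
theorem P_diag : P i i = 0 := (eval_rel (.P_diag i)).trans (PoissonTerm.eval_zero _)

variable {i j k l m}

theorem pb_P_P (h : [i, j, k, l].Nodup) : pb (P i j) (P k l) = 0 :=
  (eval_rel (.P_P i j k l h)).trans (PoissonTerm.eval_zero _)

theorem F_swap_left (h : [i, j, k].Nodup) : F i j k = -F j i k := by
  have := eval_rel (.F_swap_left i j k h)
  simpa only [PoissonTerm.eval_neg, eval_gen_F] using this

theorem F_swap_right (h : [i, j, k].Nodup) : F i j k = -F i k j := by
  have := eval_rel (.F_swap_right i j k h)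
  simpa only [PoissonTerm.eval_neg, eval_gen_F] using this

theorem pb_P_F (h : [i, j, k].Nodup) : pb (P j k) (F i j k) =
    P i k * P j k - P j k * P i j + 2 * P i k * C j - 2 * P i j * C k := by
  have := eval_rel (.P_F i j k h)
  simpa only [PoissonTerm.eval_sub, PoissonTerm.eval_add, PoissonTerm.eval_mul,
    PoissonTerm.eval_bracket, PoissonTerm.eval_const, eval_gen_C, eval_gen_P, eval_gen_F,
    map_ofNat] using this

theorem pb_P_F' (h : [i, j, k, l].Nodup) : pb (P k l) (F i j k) =
    P i k * P j l - P i l * P j k := by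
  have := eval_rel (.P_F' i j k l h)
  simpa only [PoissonTerm.eval_sub, PoissonTerm.eval_mul,
    PoissonTerm.eval_bracket, eval_gen_P, eval_gen_F] using this

theorem pb_F_F (h : [i, j, k, l].Nodup) : pb (F i j k) (F j k l) =
    F j k l * P i j - F i k l * (P j k + 2 * C j) - F i j k * P j l := by
  have := eval_rel (.F_F i j k l h)
  simpa only [PoissonTerm.eval_sub, PoissonTerm.eval_add, PoissonTerm.eval_mul,
    PoissonTerm.eval_bracket, PoissonTerm.eval_const, eval_gen_C, eval_gen_P, eval_gen_F,
    map_ofNat] using this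

theorem pb_F_F' (h : [i, j, k, l, m].Nodup) : pb (F i j k) (F k l m) =
    F i l m * P j k - P i k * F j l m := by
  have := eval_rel (.F_F' i j k l m h)
  simpa only [PoissonTerm.eval_sub, PoissonTerm.eval_mul,
    PoissonTerm.eval_bracket, eval_gen_P, eval_gen_F] using this

end Relations

theorem pb_C (i : Fin n) (a : Racah n) : pb (C i) a = 0 := by
  refine PresentedPoisson.mem_of_forall_gen (PoissonSubalgebra.commutant (C i)) ?_ a
  rintro (j | ⟨j, k⟩)
  · exact (eval_rel (.C_C i j)).trans (PoissonTerm.eval_zero _)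
  · exact (eval_rel (.C_P i j k)).trans (PoissonTerm.eval_zero _)

theorem pb_C_right (i : Fin n) (a : Racah n) : pb a (C i) = 0 := by
  rw [pb_anti, pb_C, neg_zero]

/-- To define a morphism on `R(n)` it is enough to check the relations on images `c i`, `p i j`
of the generators. -/
def lift {A : Type*} [CommRing A] [Algebra ℝ A] [PoissonAlgebra A]
    (c : Fin n → A) (p : Fin n → Fin n → A) (f : Fin n → Fin n → Fin n → A)
    (hf : ∀ i j k, f i j k = (1 / 2 : ℝ) • pb (p i j) (p j k))
    (p_symm : ∀ i j, p i j = p j i) (p_diag : ∀ i, p i i = 0)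
    (c_c : ∀ i j, pb (c i) (c j) = 0) (c_p : ∀ i j k, pb (c i) (p j k) = 0)
    (p_p : ∀ i j k l, [i, j, k, l].Nodup → pb (p i j) (p k l) = 0)
    (f_left : ∀ i j k, [i, j, k].Nodup → f i j k = -f j i k)
    (f_right : ∀ i j k, [i, j, k].Nodup → f i j k = -f i k j)
    (p_f : ∀ i j k, [i, j, k].Nodup → pb (p j k) (f i j k) =
      p i k * p j k - p j k * p i j + 2 * p i k * c j - 2 * p i j * c k)
    (p_f' : ∀ i j k l, [i, j, k, l].Nodup → pb (p k l) (f i j k) =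
      p i k * p j l - p i l * p j k)
    (f_f : ∀ i j k l, [i, j, k, l].Nodup → pb (f i j k) (f j k l) =
      f j k l * p i j - f i k l * (p j k + 2 * c j) - f i j k * p j l)
    (f_f' : ∀ i j k l m, [i, j, k, l, m].Nodup → pb (f i j k) (f k l m) =
      f i l m * p j k - p i k * f j l m) : PoissonHom (Racah n) A :=
  PresentedPoisson.lift (fun x => match x with | .C i => c i | .P i j => p i j) <| by
    set g : RacahGen n → A := fun x => match x with | .C i => c i | .P i j => p i j with hg
    have hP : ∀ i j, eval g (RacahTerm.P i j) = p i j := fun _ _ => rfl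
    have hC : ∀ i, eval g (RacahTerm.C i) = c i := fun _ => rfl
    have hF : ∀ i j k, eval g (RacahTerm.F i j k) = f i j k := fun i j k => by
      rw [hf, RacahTerm.F, PoissonTerm.eval_mul, PoissonTerm.eval_const,
        PoissonTerm.eval_bracket, hP, hP, Algebra.smul_def]
    rintro a b (_ | _ | _ | _ | ⟨_, _, _, _, h⟩ | ⟨_, _, _, h⟩ | ⟨_, _, _, h⟩ | ⟨_, _, _, h⟩ |
      ⟨_, _, _, _, h⟩ | ⟨_, _, _, _, h⟩ | ⟨_, _, _, _, _, h⟩) <;>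
    simp only [hP, hC, hF, PoissonTerm.eval_sub, PoissonTerm.eval_add, PoissonTerm.eval_mul,
      PoissonTerm.eval_bracket, PoissonTerm.eval_const, PoissonTerm.eval_neg,
      PoissonTerm.eval_zero, map_ofNat]
    · exact p_symm _ _
    · exact p_diag _
    · exact c_c _ _
    · exact c_p _ _ _
    · exact p_p _ _ _ _ h
    · exact f_left _ _ _ h
    · exact f_right _ _ _ h
    · exact p_f _ _ _ h
    · exact p_f' _ _ _ _ h
    · exact f_f _ _ _ _ h
    · exact f_f' _ _ _ _ _ h

/-! ### The Casimirs of subsets of the sites -/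

theorem cas_singleton (i : Fin n) : cas {i} = C i := by simp [cas, Finset.sum_filter]

/-- `P_AB = ∑ P_ij` over `i` in `A` and `j` in `B`. -/
def blockP (A B : Finset (Fin n)) : Racah n := ∑ i ∈ A, ∑ j ∈ B, P i j

theorem blockP_comm (A B : Finset (Fin n)) : blockP A B = blockP B A := by
  rw [blockP, Finset.sum_comm]
  simp only [blockP, P_symm]

theorem blockP_singleton (i j : Fin n) : blockP {i} {j} = P i j := by simp [blockP]

/-- The full double sum counts each pair `i < j` twice by `P_symm`, and its diagonal vanishes by
`P_diag`. -/
theorem two_mul_cas (A : Finset (Fin n)) : 2 * cas A = blockP A A + 2 * ∑ i ∈ A, C i := by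
  have h : blockP A A = (∑ i ∈ A, ∑ j ∈ A with i < j, P i j)
      + ∑ i ∈ A, ∑ j ∈ A with i < j, P i j := by
    conv_rhs => arg 2; simp only [Finset.sum_filter]; rw [Finset.sum_comm]
    simp only [Finset.sum_filter, blockP, ← Finset.sum_add_distrib]
    refine Finset.sum_congr rfl fun i _ => Finset.sum_congr rfl fun j _ => ?_
    rcases lt_trichotomy i j with h | rfl | h
    · simp [h, h.not_gt]
    · simp
    · simp [h, h.not_gt, P_symm i j]
  rw [h, cas]; ring

theorem cas_union {A B : Finset (Fin n)} (h : Disjoint A B) :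
    cas (A ∪ B) = cas A + cas B + blockP A B := by
  apply eq_of_two_mul_eq
  have h1 : blockP (A ∪ B) (A ∪ B) = blockP A A + blockP B B + 2 * blockP A B := by
    rw [two_mul]
    -- Expanding over the union produces both cross sums, `A` against `B` and `B` against `A`; one
    -- copy is transposed to match.
    nth_rw 4 [blockP_comm]
    simp only [blockP, Finset.sum_union h, Finset.sum_add_distrib]
    ring
  rw [two_mul_cas, h1, Finset.sum_union h]
  linear_combination -two_mul_cas A - two_mul_cas B

theorem P_eq_cas {i j : Fin n} (h : i ≠ j) : P i j = cas {i, j} - cas {i} - cas {j} := by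
  have : ({i, j} : Finset (Fin n)) = {i} ∪ {j} := rfl
  rw [this, cas_union (by simpa using h), blockP_singleton]; ring

/-- The Casimirs generate `R(n)`. -/
theorem mem_adjoin_cas (a : Racah n) :
    a ∈ (PoissonSubalgebra.adjoin (Set.range (cas (n := n)))).carrier := by
  have hc : ∀ A, cas A ∈ (PoissonSubalgebra.adjoin (Set.range (cas (n := n)))).carrier :=
    fun A => PoissonSubalgebra.subset_adjoin _ ⟨A, rfl⟩
  refine PresentedPoisson.mem_of_forall_gen _ ?_ a
  rintro (i | ⟨i, j⟩)
  · have := hc {i}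
    rwa [cas_singleton] at this
  · change P i j ∈ _
    rcases eq_or_ne i j with rfl | h
    · rw [P_diag]
      exact PoissonSubalgebra.zero_mem _
    · rw [P_eq_cas h]
      exact PoissonSubalgebra.sub_mem (PoissonSubalgebra.sub_mem (hc _) (hc _)) (hc _)

/-- Since the Casimirs generate, this gives both the uniqueness of the embeddings and the
commutation of the square with the realisations. -/
theorem hom_ext_cas {A : Type*} [CommRing A] [Algebra ℝ A] [PoissonAlgebra A]
    {φ ψ : PoissonHom (Racah n) A} (h : ∀ B, φ (cas B) = ψ (cas B)) (a : Racah n) :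
    φ a = ψ a :=
  mem_adjoin_cas a (PoissonHom.equalizer φ ψ) (by rintro _ ⟨B, rfl⟩; exact h B)

/-! ### Brackets of block sums -/

/-- Dropping `i ≠ j` and `k ≠ l` costs nothing because `P i i = 0`, and it allows sums over full
blocks. -/
theorem pb_P_P_of_disjoint {i j k l : Fin n} (hik : i ≠ k) (hil : i ≠ l) (hjk : j ≠ k)
    (hjl : j ≠ l) : pb (P i j) (P k l) = 0 := by
  rcases eq_or_ne i j with rfl | hij
  · simp
  rcases eq_or_ne k l with rfl | hkl
  · simp
  exact pb_P_P (by simp_all)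

theorem pb_P_P_eq_F {i j k : Fin n} : pb (P i j) (P j k) = 2 * F i j k :=
  (two_mul_half_smul _).symm

/-- `{P_ij, P_ik + P_jk} = 0`. -/
theorem pb_P_add {i j k : Fin n} (h : [i, j, k].Nodup) :
    pb (P i j) (P i k) + pb (P i j) (P j k) = 0 := by
  rw [P_symm i j, pb_P_P_eq_F, P_symm j i, pb_P_P_eq_F, F_swap_left h]
  ring

theorem pb_blockP (A B : Finset (Fin n)) (a : Racah n) :
    pb (blockP A B) a = ∑ i ∈ A, ∑ j ∈ B, pb (P i j) a := by
  simp only [blockP, map_sum, LinearMap.sum_apply]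

theorem pb_cas (A : Finset (Fin n)) (a : Racah n) :
    2 * pb (cas A) a = ∑ i ∈ A, ∑ j ∈ A, pb (P i j) a := by
  have h : ∀ x : Racah n, 2 * pb x a = pb (2 * x) a := fun x => by
    rw [two_mul, two_mul, map_add, LinearMap.add_apply]
  have h' : ∀ x : Racah n, pb (2 * x) a = 2 * pb x a := fun x => (h x).symm
  rw [h, two_mul_cas, map_add, LinearMap.add_apply, h', map_sum, LinearMap.sum_apply,
    pb_blockP]
  simp [pb_C]

theorem pb_cas_blockP_of_disjoint {A B D : Finset (Fin n)} (hAB : Disjoint A B)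
    (hAD : Disjoint A D) : pb (cas A) (blockP B D) = 0 := by
  apply eq_of_two_mul_eq
  rw [pb_cas, mul_zero]
  refine Finset.sum_eq_zero fun i hi => Finset.sum_eq_zero fun j hj => ?_
  simp only [blockP, map_sum]
  exact Finset.sum_eq_zero fun b hb => Finset.sum_eq_zero fun d hd =>
    pb_P_P_of_disjoint (Finset.disjoint_left.1 hAB hi <| · ▸ hb)
      (Finset.disjoint_left.1 hAD hi <| · ▸ hd) (Finset.disjoint_left.1 hAB hj <| · ▸ hb)
      (Finset.disjoint_left.1 hAD hj <| · ▸ hd)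

/-- Together with `pb_cas_blockP_of_disjoint` this makes the Casimir of a block commute with the
merged generators, as the centrality of `C q` requires. -/
theorem pb_cas_blockP_self {A B : Finset (Fin n)} (hAB : Disjoint A B) :
    pb (cas A) (blockP A B) = 0 := by
  have hne : ∀ {a b}, a ∈ A → b ∈ B → a ≠ b := fun ha hb h =>
    Finset.disjoint_left.1 hAB ha (h ▸ hb)
  apply eq_of_two_mul_eq
  rw [pb_cas, mul_zero]
  refine Finset.sum_eq_zero fun i hi => Finset.sum_eq_zero fun j hj => ?_
  rcases eq_or_ne i j with rfl | hij
  · simp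
  rw [blockP, Finset.sum_comm]
  simp only [map_sum]
  refine Finset.sum_eq_zero fun b hb => ?_
  -- Among the `P l b` with `l ∈ A` only `l = i` and `l = j` can fail to commute with `P i j`, and
  -- their contributions cancel.
  rw [← Finset.sum_subset (s₁ := {i, j}), Finset.sum_pair hij]
  · exact pb_P_add (by simp [hij, hne hi hb, hne hj hb])
  · simp [Finset.insert_subset_iff, hi, hj]
  · intro l hl hl'
    simp only [Finset.mem_insert, Finset.mem_singleton, not_or] at hl'
    exact pb_P_P_of_disjoint (Ne.symm hl'.1) (hne hi hb) (Ne.symm hl'.2) (hne hj hb)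

theorem pb_cas_cas_of_disjoint {A B : Finset (Fin n)} (hAB : Disjoint A B) :
    pb (cas A) (cas B) = 0 := by
  apply eq_of_two_mul_eq
  have h : 2 * pb (cas A) (cas B) = pb (cas A) (2 * cas B) := by
    rw [two_mul, two_mul, map_add]
  rw [h, two_mul_cas, map_add, pb_cas_blockP_of_disjoint hAB hAB, two_mul, map_add, map_sum]
  simp [pb_C_right]

/-- `F_ABD = ∑ F_abd` over `a` in `A`, `b` in `B`, `d` in `D`. -/
def blockF (A B D : Finset (Fin n)) : Racah n := ∑ a ∈ A, ∑ b ∈ B, ∑ d ∈ D, F a b d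

section Blocks

variable {A B D : Finset (Fin n)}

theorem nodup_of_mem_blocks (hAB : Disjoint A B) (hAD : Disjoint A D) (hBD : Disjoint B D)
    {a b d : Fin n} (ha : a ∈ A) (hb : b ∈ B) (hd : d ∈ D) :
    [a, b, d].Nodup := by
  have h1 : a ≠ b := fun h => Finset.disjoint_left.1 hAB ha (h ▸ hb)
  have h2 : a ≠ d := fun h => Finset.disjoint_left.1 hAD ha (h ▸ hd)
  have h3 : b ≠ d := fun h => Finset.disjoint_left.1 hBD hb (h ▸ hd)
  simp [h1, h2, h3]

/-- In the expansion over `P a b` and `P b' d` the terms with `b ≠ b'` involve disjoint pairs and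
vanish; those with `b = b'` are the `F a b d`. -/
theorem blockF_eq (hAB : Disjoint A B) (hAD : Disjoint A D) (hBD : Disjoint B D) :
    blockF A B D = (1 / 2 : ℝ) • pb (blockP A B) (blockP B D) := by
  rw [pb_blockP]
  simp only [blockP, map_sum, Finset.smul_sum, blockF]
  refine Finset.sum_congr rfl fun a ha => Finset.sum_congr rfl fun b hb => ?_
  rw [Finset.sum_eq_single_of_mem b hb]
  · rfl
  intro b' hb' hbb'
  refine Finset.sum_eq_zero fun d hd => ?_
  have h1 := nodup_of_mem_blocks hAB hAD hBD ha hb hd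
  have h2 := nodup_of_mem_blocks hAB hAD hBD ha hb' hd
  simp only [List.nodup_cons, List.mem_cons, not_or, List.not_mem_nil, not_false_eq_true,
    and_true, true_and] at h1 h2
  rw [pb_P_P_of_disjoint h2.1.1 h2.1.2 (Ne.symm hbb') h1.2.1, smul_zero]

theorem blockF_swap_left (hAB : Disjoint A B) (hAD : Disjoint A D) (hBD : Disjoint B D) :
    blockF A B D = -blockF B A D := by
  rw [blockF, Finset.sum_comm]
  simp only [blockF, ← Finset.sum_neg_distrib]
  exact Finset.sum_congr rfl fun b hb => Finset.sum_congr rfl fun a ha =>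
    Finset.sum_congr rfl fun d hd => F_swap_left (nodup_of_mem_blocks hAB hAD hBD ha hb hd)

theorem blockF_swap_right (hAB : Disjoint A B) (hAD : Disjoint A D) (hBD : Disjoint B D) :
    blockF A B D = -blockF A D B := by
  simp only [blockF, ← Finset.sum_neg_distrib]
  refine Finset.sum_congr rfl fun a ha => ?_
  rw [Finset.sum_comm (s := D)]
  exact Finset.sum_congr rfl fun b hb => Finset.sum_congr rfl fun d hd =>
    F_swap_right (nodup_of_mem_blocks hAB hAD hBD ha hb hd)

end Blocks

/-! ### The relation `P_F` for block sums. -/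

/-- The Gram matrix: `P_ij` off the diagonal and `2 C_i` on it. -/
def gram (i j : Fin n) : Racah n := P i j + if i = j then 2 * C i else 0

theorem gram_of_ne {i j : Fin n} (h : i ≠ j) : gram i j = P i j := by simp [gram, h]

theorem gram_self (i : Fin n) : gram i i = 2 * C i := by simp [gram]

theorem sum_gram (A : Finset (Fin n)) : ∑ i ∈ A, ∑ j ∈ A, gram i j = 2 * cas A := by
  rw [two_mul_cas]
  simp only [gram, Finset.sum_add_distrib, blockP, Finset.mul_sum]
  congr 1
  refine Finset.sum_congr rfl fun i hi => ?_
  simp [hi]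

/-- `P_F`, `P_F'` and the vanishing of brackets of disjoint pairs are the cases of one formula,
according to whether `d = d'` and `b = b'`. The diagonal entries `2 C` of `gram` account for the
extra terms of `P_F`. -/
theorem pb_P_F_gram {a b d b' d' : Fin n} (h1 : [a, b, d].Nodup) (h2 : [a, b', d'].Nodup)
    (h3 : b ≠ d') (h4 : d ≠ b') : pb (P b d) (F a b' d') =
      (if d = d' then P a d * gram b' b - P a b * P b' d else 0)
        + if b = b' then P d' b * P a d - gram d' d * P a b else 0 := by
  simp only [List.nodup_cons, List.mem_cons, not_or, List.not_mem_nil, not_false_eq_true,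
    and_true, List.nodup_nil] at h1 h2
  obtain ⟨⟨hab, had⟩, hbd⟩ := h1
  obtain ⟨⟨hab', had'⟩, hbd'⟩ := h2
  by_cases hd : d = d' <;> by_cases hb : b = b'
  · subst hd hb
    rw [pb_P_F (by simp_all)]
    simp only [if_true, gram_self, P_symm d b]
    ring
  · subst hd
    rw [P_symm b d, pb_P_F' (by simp_all [eq_comm])]
    simp only [if_true, hb, if_false, gram_of_ne (Ne.symm hb)]
    ring
  · subst hb
    -- Two transpositions bring the shared index `b` to the last place, as `pb_P_F'` requires.
    rw [F_swap_right (by simp_all), F_swap_left (by simp_all [eq_comm]), neg_neg,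
      pb_P_F' (by simp_all [eq_comm])]
    simp only [if_true, hd, if_false, gram_of_ne (Ne.symm hd)]
    ring
  · simp only [hd, hb, if_false, add_zero, F, map_smul]
    rw [pb_pb, pb_P_P_of_disjoint (Ne.symm hab) hb (Ne.symm had) h4,
      pb_P_P_of_disjoint hb h3 h4 hd]
    simp

/-- The only quadratic relation that survives for three blocks. In the sum of `pb_P_F_gram` the
terms with `d = d'` produce the Casimir of `B` and those with `b = b'` the Casimir of `D`, both
through `sum_gram`. -/
theorem pb_blockP_blockF {A B D : Finset (Fin n)} (hAB : Disjoint A B) (hAD : Disjoint A D)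
    (hBD : Disjoint B D) : pb (blockP B D) (blockF A B D) =
      blockP A D * blockP B D - blockP B D * blockP A B + 2 * blockP A D * cas B
        - 2 * blockP A B * cas D := by
  have hne : ∀ {b d}, b ∈ B → d ∈ D → b ≠ d := fun hb hd h =>
    Finset.disjoint_left.1 hBD hb (h ▸ hd)
  have key : pb (blockP B D) (blockF A B D) =
      ∑ b ∈ B, ∑ d ∈ D, ∑ a ∈ A, ∑ b' ∈ B, ∑ d' ∈ D,
        ((if d = d' then P a d * gram b' b - P a b * P b' d else 0)
          + if b = b' then P d' b * P a d - gram d' d * P a b else 0) := by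
    rw [pb_blockP]
    simp only [blockF, map_sum]
    refine Finset.sum_congr rfl fun b hb => Finset.sum_congr rfl fun d hd =>
      Finset.sum_congr rfl fun a ha => Finset.sum_congr rfl fun b' hb' =>
      Finset.sum_congr rfl fun d' hd' => ?_
    exact pb_P_F_gram (nodup_of_mem_blocks hAB hAD hBD ha hb hd)
      (nodup_of_mem_blocks hAB hAD hBD ha hb' hd') (hne hb hd') (hne hb' hd).symm
  have h1 : ∑ b ∈ B, ∑ d ∈ D, ∑ a ∈ A, ∑ b' ∈ B, ∑ d' ∈ D,
      (if d = d' then P a d * gram b' b - P a b * P b' d else 0) =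
        blockP A D * (2 * cas B) - blockP A B * blockP B D := by
    calc _ = ∑ b ∈ B, ∑ d ∈ D, ∑ a ∈ A, ∑ b' ∈ B, (P a d * gram b' b - P a b * P b' d) := by
          refine Finset.sum_congr rfl fun b _ => Finset.sum_congr rfl fun d hd =>
            Finset.sum_congr rfl fun a _ => Finset.sum_congr rfl fun b' _ => ?_
          simp [hd]
      _ = _ := by
          simp only [Finset.sum_sub_distrib]
          refine congrArg₂ (· - ·) ?_ ?_
          · simp only [← Finset.mul_sum, ← Finset.sum_mul]
            rw [Finset.sum_comm (s := D), Finset.sum_comm (s := B), sum_gram, blockP]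
          · simp only [← Finset.mul_sum, ← Finset.sum_mul]
            rw [Finset.sum_comm (s := D), Finset.sum_comm (s := B) (t := A), blockP, blockP]
  have h2 : ∑ b ∈ B, ∑ d ∈ D, ∑ a ∈ A, ∑ b' ∈ B, ∑ d' ∈ D,
      (if b = b' then P d' b * P a d - gram d' d * P a b else 0) =
        blockP B D * blockP A D - 2 * cas D * blockP A B := by
    calc _ = ∑ b ∈ B, ∑ d ∈ D, ∑ a ∈ A, ∑ d' ∈ D, (P d' b * P a d - gram d' d * P a b) := by
          refine Finset.sum_congr rfl fun b hb => Finset.sum_congr rfl fun d _ =>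
            Finset.sum_congr rfl fun a _ => ?_
          rw [Finset.sum_comm]
          refine Finset.sum_congr rfl fun d' _ => ?_
          simp [hb]
      _ = _ := by
          simp only [Finset.sum_sub_distrib]
          refine congrArg₂ (· - ·) ?_ ?_
          · simp only [← Finset.mul_sum, ← Finset.sum_mul]
            rw [Finset.sum_comm (s := D) (t := A), blockP_comm B D, blockP, blockP,
              Finset.sum_comm (s := B) (t := D)]
          · simp only [← Finset.mul_sum, ← Finset.sum_mul]
            rw [Finset.sum_comm (s := B) (t := A), Finset.sum_comm (s := D), sum_gram, blockP]
  rw [key]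
  simp only [Finset.sum_add_distrib]
  rw [h1, h2]
  ring

end Racah

/-! ### Merging sites into three blocks -/

namespace Racah

variable {n m : ℕ}

/-- Makes the relations of `R(3)` in four distinct letters vacuous; the next lemma does so for five.
-/
theorem not_nodup_four {i j k l : Fin 3} : ¬[i, j, k, l].Nodup := fun h => by
  simpa using h.length_le_card

theorem not_nodup_five {i j k l p : Fin 3} : ¬[i, j, k, l, p].Nodup := fun h => by
  simpa using h.length_le_card

theorem nodup_three {α : Type*} {i j k : α} :
    [i, j, k].Nodup ↔ i ≠ j ∧ i ≠ k ∧ j ≠ k := by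
  simp [and_assoc]

/-- The image of `P_qr` under the merging of sites. -/
def mergedP (K : Fin m → Finset (Fin n)) (q r : Fin m) : Racah n :=
  -- The diagonal must be `0` to match `P_diag`; `blockP (K q) (K q)` is twice the sum over pairs
  -- inside the block.
  if q = r then 0 else blockP (K q) (K r)

theorem mergedP_of_ne {K : Fin m → Finset (Fin n)} {q r : Fin m} (h : q ≠ r) :
    mergedP K q r = blockP (K q) (K r) := if_neg h

theorem half_pb_mergedP {K : Fin m → Finset (Fin n)} (hK : Pairwise fun q r => Disjoint (K q) (K r))
    {q r s : Fin m} (h : [q, r, s].Nodup) :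
    (1 / 2 : ℝ) • pb (mergedP K q r) (mergedP K r s) = blockF (K q) (K r) (K s) := by
  obtain ⟨h1, h2, h3⟩ := nodup_three.1 h
  rw [blockF_eq (hK h1) (hK h2) (hK h3), mergedP_of_ne h1, mergedP_of_ne h3]

/-- The morphism `R(3) → R(n)` that merges the sites of each of three disjoint blocks. -/
def merge (K : Fin 3 → Finset (Fin n)) (hK : Pairwise fun q r => Disjoint (K q) (K r)) :
    PoissonHom (Racah 3) (Racah n) :=
  lift (fun q => cas (K q)) (mergedP K)
    (fun q r s => (1 / 2 : ℝ) • pb (mergedP K q r) (mergedP K r s)) (fun _ _ _ => rfl)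
    (fun q r => by simp only [mergedP, blockP_comm, eq_comm])
    (fun q => if_pos rfl)
    (fun q r => by
      rcases eq_or_ne q r with rfl | h
      · exact pb_self _
      · exact pb_cas_cas_of_disjoint (hK h))
    (fun q r s => by
      rcases eq_or_ne r s with rfl | hrs
      · simp [mergedP]
      rw [mergedP_of_ne hrs]
      rcases eq_or_ne q r with rfl | hqr
      · exact pb_cas_blockP_self (hK hrs)
      rcases eq_or_ne q s with rfl | hqs
      · rw [blockP_comm]
        exact pb_cas_blockP_self (hK hqr)
      exact pb_cas_blockP_of_disjoint (hK hqr) (hK hqs))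
    (fun _ _ _ _ h => absurd h not_nodup_four)
    (fun q r s h => by
      obtain ⟨h1, h2, h3⟩ := nodup_three.1 h
      rw [half_pb_mergedP hK h, half_pb_mergedP hK (nodup_three.2 ⟨h1.symm, h3, h2⟩)]
      exact blockF_swap_left (hK h1) (hK h2) (hK h3))
    (fun q r s h => by
      obtain ⟨h1, h2, h3⟩ := nodup_three.1 h
      rw [half_pb_mergedP hK h, half_pb_mergedP hK (nodup_three.2 ⟨h2, h1, h3.symm⟩)]
      exact blockF_swap_right (hK h1) (hK h2) (hK h3))
    (fun q r s h => by
      obtain ⟨h1, h2, h3⟩ := nodup_three.1 h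
      rw [half_pb_mergedP hK h, mergedP_of_ne h1, mergedP_of_ne h2, mergedP_of_ne h3]
      exact pb_blockP_blockF (hK h1) (hK h2) (hK h3))
    (fun _ _ _ _ h => absurd h not_nodup_four)
    (fun _ _ _ _ h => absurd h not_nodup_four)
    (fun _ _ _ _ _ h => absurd h not_nodup_five)

theorem cas_empty : cas (∅ : Finset (Fin n)) = 0 := by simp [cas]

theorem cas_insert {i : Fin n} {A : Finset (Fin n)} (h : i ∉ A) :
    cas (insert i A) = C i + cas A + ∑ j ∈ A, P i j := by
  rw [Finset.insert_eq, cas_union (by simpa using h), cas_singleton]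
  simp [blockP]

section Merge

variable {K : Fin 3 → Finset (Fin n)} (hK : Pairwise fun q r => Disjoint (K q) (K r))

theorem merge_C (q : Fin 3) : merge K hK (C q) = cas (K q) := rfl

theorem merge_P (q r : Fin 3) : merge K hK (P q r) = mergedP K q r := rfl

/-- Adding an index `q` to `B` adds the cross terms `P q r` with `r ∈ B`, whose images make up the
cross term of `K q` with the union of the other blocks. -/
theorem merge_cas (B : Finset (Fin 3)) : merge K hK (cas B) = cas (B.biUnion K) := by
  induction B using Finset.induction_on with
  | empty => simp [cas_empty]
  | insert q B hq ih =>
    have hne : ∀ r ∈ B, q ≠ r := fun r hr h => hq (h ▸ hr)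
    have hpair : (B : Set (Fin 3)).PairwiseDisjoint K := fun r _ s _ hrs => hK hrs
    rw [cas_insert hq, Finset.biUnion_insert, cas_union, map_add, map_add, ih, merge_C, map_sum]
    · congr 1
      rw [blockP, Finset.sum_comm, Finset.sum_biUnion hpair]
      refine Finset.sum_congr rfl fun r hr => ?_
      rw [merge_P, mergedP_of_ne (hne r hr), blockP, Finset.sum_comm]
    · exact (Finset.disjoint_biUnion_right _ _ _).2 fun r hr => hK (hne r hr)

end Merge

/-! ### Restriction to a subset of the sites -/

/-- The function `c`, extended by zero. -/
def extendC (c : Fin m → Racah m) : Option (Fin m) → Racah m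
  | some q => c q
  | none => 0

/-- The function `p`, extended by zero. -/
def extendP (p : Fin m → Fin m → Racah m) : Option (Fin m) → Option (Fin m) → Racah m
  | some q, some r => p q r
  | _, _ => 0

set_option linter.unusedSimpArgs false in
/-- The morphism `R(n) → R(m)` that forgets the sites outside the range of `r`. -/
def restrict (r : Fin m → Fin n) (s : Fin n → Option (Fin m)) (hs : Function.IsPartialInv r s) :
    PoissonHom (Racah n) (Racah m) := by
  have hr : ∀ {i q}, s i = some q → i = r q := fun h => ((hs _ _).1 h).symm
  -- Every monomial in a defining relation involves all indices of that relation, so forgetting any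
  -- of these sites turns both sides into zero. If all are kept, the relation is the one in `R(m)`
  -- for their preimages, which are distinct because their images under `r` are.
  refine lift (fun i => extendC C (s i)) (fun i j => extendP P (s i) (s j))
    (fun i j k => (1 / 2 : ℝ) • pb (extendP P (s i) (s j)) (extendP P (s j) (s k)))
    (fun _ _ _ => rfl) ?_ ?_ ?_ ?_ ?_ ?_ ?_ ?_ ?_ ?_ ?_
  · intro i j
    rcases s i with _ | a <;> rcases s j with _ | b <;> simp [extendP, P_symm]
  · intro i
    rcases s i with _ | a <;> simp [extendP]
  · intro i j
    rcases s i with _ | a <;> simp [extendC, pb_C]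
  · intro i j k
    rcases s i with _ | a <;> simp [extendC, pb_C]
  · intro i j k l h
    rcases hi : s i with _ | a <;>
      rcases hj : s j with _ | b <;>
      rcases hk : s k with _ | c <;>
      rcases hl : s l with _ | d <;>
      simp only [extendP, extendC, map_zero, LinearMap.zero_apply, smul_zero, mul_zero,
        zero_mul, sub_zero, add_zero, neg_zero]
    rw [hr hi, hr hj, hr hk, hr hl] at h
    exact pb_P_P (h.of_map r (l := [a, b, c, d]))
  · intro i j k h
    rcases hi : s i with _ | a <;>
      rcases hj : s j with _ | b <;>
      rcases hk : s k with _ | c <;>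
      simp only [extendP, extendC, map_zero, LinearMap.zero_apply, smul_zero, mul_zero,
        zero_mul, sub_zero, add_zero, neg_zero]
    rw [hr hi, hr hj, hr hk] at h
    exact F_swap_left (h.of_map r (l := [a, b, c]))
  · intro i j k h
    rcases hi : s i with _ | a <;>
      rcases hj : s j with _ | b <;>
      rcases hk : s k with _ | c <;>
      simp only [extendP, extendC, map_zero, LinearMap.zero_apply, smul_zero, mul_zero,
        zero_mul, sub_zero, add_zero, neg_zero]
    rw [hr hi, hr hj, hr hk] at h
    exact F_swap_right (h.of_map r (l := [a, b, c]))
  · intro i j k h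
    rcases hi : s i with _ | a <;>
      rcases hj : s j with _ | b <;>
      rcases hk : s k with _ | c <;>
      simp only [extendP, extendC, map_zero, LinearMap.zero_apply, smul_zero, mul_zero,
        zero_mul, sub_zero, add_zero, neg_zero]
    rw [hr hi, hr hj, hr hk] at h
    exact pb_P_F (h.of_map r (l := [a, b, c]))
  · intro i j k l h
    rcases hi : s i with _ | a <;>
      rcases hj : s j with _ | b <;>
      rcases hk : s k with _ | c <;>
      rcases hl : s l with _ | d <;>
      simp only [extendP, extendC, map_zero, LinearMap.zero_apply, smul_zero, mul_zero,
        zero_mul, sub_zero, add_zero, neg_zero]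
    rw [hr hi, hr hj, hr hk, hr hl] at h
    exact pb_P_F' (h.of_map r (l := [a, b, c, d]))
  · intro i j k l h
    rcases hi : s i with _ | a <;>
      rcases hj : s j with _ | b <;>
      rcases hk : s k with _ | c <;>
      rcases hl : s l with _ | d <;>
      simp only [extendP, extendC, map_zero, LinearMap.zero_apply, smul_zero, mul_zero,
        zero_mul, sub_zero, add_zero, neg_zero]
    rw [hr hi, hr hj, hr hk, hr hl] at h
    exact pb_F_F (h.of_map r (l := [a, b, c, d]))
  · intro i j k l p h
    rcases hi : s i with _ | a <;>
      rcases hj : s j with _ | b <;>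
      rcases hk : s k with _ | c <;>
      rcases hl : s l with _ | d <;>
      rcases hp : s p with _ | e <;>
      simp only [extendP, extendC, map_zero, LinearMap.zero_apply, smul_zero, mul_zero,
        zero_mul, sub_zero, add_zero, neg_zero]
    rw [hr hi, hr hj, hr hk, hr hl, hr hp] at h
    exact pb_F_F' (h.of_map r (l := [a, b, c, d, e]))

section Restrict

variable {r : Fin m → Fin n} {s : Fin n → Option (Fin m)} (hs : Function.IsPartialInv r s)

theorem restrict_P (i j : Fin n) : restrict r s hs (P i j) = extendP P (s i) (s j) := rfl

/-- The block `A` contains a single kept site, `r q`; all others contribute `g none = 0`. -/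
theorem sum_extend (hs : Function.IsPartialInv r s) {A : Finset (Fin n)} {q : Fin m}
    (hA : ∀ p, r p ∈ A ↔ p = q) {g : Option (Fin m) → Racah m} (hg : g none = 0) : ∑ i ∈ A, g (s i) = g (some q) := by
  rw [Finset.sum_eq_single_of_mem (r q) ((hA q).2 rfl), (hs q (r q)).2 rfl]
  intro i hi hiq
  rcases h : s i with _ | q'
  · exact hg
  · have h' := (hs _ _).1 h
    obtain rfl : q' = q := (hA q').1 (h'.symm ▸ hi)
    exact absurd h'.symm hiq

theorem restrict_blockP {A B : Finset (Fin n)} {q q' : Fin m} (hA : ∀ p, r p ∈ A ↔ p = q)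
    (hB : ∀ p, r p ∈ B ↔ p = q') : restrict r s hs (blockP A B) = P q q' := by
  simp only [blockP, map_sum, restrict_P]
  have h : ∀ x : Option (Fin m), ∑ j ∈ B, extendP P x (s j) = extendP P x (some q') := fun x =>
    sum_extend hs hB (by cases x <;> rfl)
  simp only [h]
  exact sum_extend hs hA (g := fun x => extendP P x (some q')) rfl

theorem restrict_cas {A : Finset (Fin n)} {q : Fin m} (hA : ∀ p, r p ∈ A ↔ p = q) :
    restrict r s hs (cas A) = C q := by
  apply eq_of_two_mul_eq
  have h : ∀ x, 2 * restrict r s hs x = restrict r s hs (2 * x) := fun x => by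
    rw [map_mul, map_ofNat]
  rw [h, two_mul_cas, map_add, restrict_blockP hs hA hA, P_diag, ← h, map_sum, zero_add]
  exact congrArg _ (sum_extend hs hA (g := extendC C) rfl)

end Restrict

theorem hom_ext {A : Type*} [CommRing A] [Algebra ℝ A] [PoissonAlgebra A]
    {φ ψ : PoissonHom (Racah n) A} (hC : ∀ i, φ (C i) = ψ (C i))
    (hP : ∀ i j, i ≠ j → φ (P i j) = ψ (P i j)) (a : Racah n) : φ a = ψ a := by
  refine PresentedPoisson.mem_of_forall_gen (PoissonHom.equalizer φ ψ) ?_ a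
  rintro (i | ⟨i, j⟩)
  · exact hC i
  · change φ (P i j) = ψ (P i j)
    rcases eq_or_ne i j with rfl | h
    · simp
    · exact hP i j h

/-- With one site `r q` chosen in each block, forgetting all other sites undoes the merging. -/
theorem merge_injective {K : Fin 3 → Finset (Fin n)}
    (hK : Pairwise fun q r => Disjoint (K q) (K r)) (hne : ∀ q, (K q).Nonempty) :
    Function.Injective (merge K hK) := by
  choose r hr using hne
  have hrK : ∀ q p, r p ∈ K q ↔ p = q := fun q p => by
    refine ⟨fun h => ?_, fun h => h ▸ hr p⟩
    by_contra hpq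
    exact Finset.disjoint_left.1 (hK hpq) (hr p) h
  have hinj : Function.Injective r := fun p q h => (hrK q p).1 (h ▸ hr q)
  have hs := hinj.isPartialInv
  have key : ∀ x, restrict r _ hs (merge K hK x) = x := by
    refine hom_ext (φ := (restrict r _ hs).comp (merge K hK)) (ψ := PoissonHom.id _) ?_ ?_
    · intro q
      exact restrict_cas hs (hrK q)
    · intro q p hqp
      rw [PoissonHom.comp_apply, merge_P, mergedP_of_ne hqp]
      exact restrict_blockP hs (hrK q) (hrK p)
  exact Function.LeftInverse.injective key

end Racah

/-! ### The realisation of `R(n)` in the Poisson coalgebra -/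

namespace Chain

open SL2Gen MvPolynomial

variable {n m : ℕ}

theorem pb_J (i j : Fin n) (σ τ : SL2Gen) :
    pb (J i σ) (J j τ) = if i = j then genBracket i σ τ else 0 := ham_X i j σ τ

theorem pb_J_of_ne {i j : Fin n} (h : i ≠ j) (σ τ : SL2Gen) : pb (J i σ) (J j τ) = 0 := by
  rw [pb_J, if_neg h]

theorem pb_J_self (i : Fin n) (σ τ : SL2Gen) : pb (J i σ) (J i τ) = genBracket i σ τ := by
  rw [pb_J, if_pos rfl]

/-- The invariant bilinear form: `dot i j` is the polarisation of the Casimir. -/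
def dot (i j : Fin n) : Chain n :=
  2 * J i three * J j three - J i plus * J j minus - J i minus * J j plus

/-- The invariant trilinear form. -/
def det (i j k : Fin n) : Chain n :=
  J i plus * (J j three * J k minus - J j minus * J k three)
    + J i three * (J j minus * J k plus - J j plus * J k minus)
    + J i minus * (J j plus * J k three - J j three * J k plus)

theorem pb_two (a : Chain n) : pb a 2 = 0 := by
  rw [← map_ofNat (algebraMap ℝ (Chain n)) 2, pb_algebraMap]

theorem pb_two_left (a : Chain n) : pb 2 a = 0 := by rw [pb_anti, pb_two, neg_zero]

theorem siteCas_eq (i : Fin n) : siteCas i = J i three * J i three - J i plus * J i minus := by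
  rw [siteCas, casimirFun, sq]

theorem pb_siteCas_J (i j : Fin n) (σ : SL2Gen) : pb (siteCas i) (J j σ) = 0 := by
  rcases eq_or_ne i j with rfl | h
  · rw [siteCas_eq]
    cases σ <;> simp only [map_sub, LinearMap.sub_apply, pb_mul_left, pb_J_self, genBracket,
      ofNat_smul_eq_nsmul, nsmul_eq_mul, Nat.cast_ofNat] <;> ring
  · simp [siteCas_eq, pb_mul_left, pb_J_of_ne h]

theorem pb_eq_zero_of_J {f : Chain n} (h : ∀ i σ, pb f (J i σ) = 0) (g : Chain n) :
    pb f g = 0 := by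
  induction g using MvPolynomial.induction_on with
  | C r => exact pb_algebraMap f r
  | add p q hp hq => rw [map_add, hp, hq, add_zero]
  | mul_X p v hp =>
    have hv : pb f (X v) = 0 := h v.1 v.2
    rw [pb_mul, hp, hv]; ring

theorem pb_siteCas (i : Fin n) (f : Chain n) : pb (siteCas i) f = 0 :=
  pb_eq_zero_of_J (pb_siteCas_J i) f

/-! ### Brackets of the invariant forms. -/

section Dot

variable {i j k l p : Fin n}

theorem dot_comm (i j : Fin n) : dot i j = dot j i := by
  simp only [dot]; ring

theorem dot_self (i : Fin n) : dot i i = 2 * siteCas i := by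
  simp only [dot, siteCas_eq]; ring

theorem pb_dot_J_of_ne (hi : i ≠ l) (hj : j ≠ l) (σ : SL2Gen) : pb (dot i j) (J l σ) = 0 := by
  simp [dot, pb_mul_left, pb_J_of_ne hi, pb_J_of_ne hj, pb_two_left]

/-- For `i ≠ j` the form is linear in the generators at site `j`, and those at site `i` act as
constants. From such values the Leibniz rule reduces each relation of `R(n)` to a polynomial
identity. -/
theorem pb_dot_J (h : i ≠ j) (σ : SL2Gen) : pb (dot i j) (J j σ) =
    2 * J i three * genBracket j three σ - J i plus * genBracket j minus σ
      - J i minus * genBracket j plus σ := by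
  simp only [dot, pb_mul_left, pb_J_of_ne h, pb_J_self, pb_two_left, map_sub,
    LinearMap.sub_apply]
  ring

theorem pb_dot_J_left (h : i ≠ j) (σ : SL2Gen) : pb (dot i j) (J i σ) =
    2 * J j three * genBracket i three σ - J j plus * genBracket i minus σ
      - J j minus * genBracket i plus σ := by
  rw [dot_comm, pb_dot_J h.symm]

/-- This fixes the normalisation: `det i j k` is the realisation of `F i j k`. -/
theorem pb_dot_dot (hij : i ≠ j) (hik : i ≠ k) (hjk : j ≠ k) :
    pb (dot i j) (dot j k) = 2 * det i j k := by
  have h : ∀ σ, pb (dot i j) (J k σ) = 0 := pb_dot_J_of_ne hik hjk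
  conv_lhs => arg 2; rw [dot]
  simp only [map_sub, pb_two, pb_mul, h, pb_dot_J hij, genBracket,
    ofNat_smul_eq_nsmul, nsmul_eq_mul, Nat.cast_ofNat, det]
  ring

theorem det_swap_left (i j k : Fin n) : det i j k = -det j i k := by
  simp only [det]; ring

theorem det_swap_right (i j k : Fin n) : det i j k = -det i k j := by
  simp only [det]; ring

theorem pb_dot_det (hij : i ≠ j) (hik : i ≠ k) (hjk : j ≠ k) : pb (dot j k) (det i j k) =
    dot i k * dot j k - dot j k * dot i j + 2 * dot i k * siteCas j
      - 2 * dot i j * siteCas k := by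
  have hi : ∀ σ, pb (dot j k) (J i σ) = 0 := pb_dot_J_of_ne hij.symm hik.symm
  rw [det]
  simp only [map_add, map_sub, pb_mul, hi, pb_dot_J_left hjk, pb_dot_J hjk, genBracket,
    ofNat_smul_eq_nsmul, nsmul_eq_mul, Nat.cast_ofNat, siteCas_eq]
  simp only [dot]
  ring

theorem pb_dot_det' (hik : i ≠ k) (hjk : j ≠ k) (hil : i ≠ l) (hjl : j ≠ l) (hkl : k ≠ l) :
    pb (dot k l) (det i j k) = dot i k * dot j l - dot i l * dot j k := by
  have hi : ∀ σ, pb (dot k l) (J i σ) = 0 := pb_dot_J_of_ne hik.symm hil.symm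
  have hj : ∀ σ, pb (dot k l) (J j σ) = 0 := pb_dot_J_of_ne hjk.symm hjl.symm
  rw [det]
  simp only [map_add, map_sub, pb_mul, hi, hj, pb_dot_J_left hkl, genBracket,
    ofNat_smul_eq_nsmul, nsmul_eq_mul, Nat.cast_ofNat]
  simp only [dot]
  ring

theorem pb_det_J_of_ne (hi : i ≠ l) (hj : j ≠ l) (hk : k ≠ l) (σ : SL2Gen) :
    pb (det i j k) (J l σ) = 0 := by
  simp [det, pb_mul_left, pb_J_of_ne hi, pb_J_of_ne hj, pb_J_of_ne hk]

theorem pb_det_J (hik : i ≠ k) (hjk : j ≠ k) (σ : SL2Gen) : pb (det i j k) (J k σ) =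
    (J i plus * J j three - J i three * J j plus) * genBracket k minus σ
      + (J i three * J j minus - J i minus * J j three) * genBracket k plus σ
      + (J i minus * J j plus - J i plus * J j minus) * genBracket k three σ := by
  simp only [det, pb_mul_left, pb_J_of_ne hik, pb_J_of_ne hjk, pb_J_self, map_add, map_sub,
    LinearMap.add_apply, LinearMap.sub_apply]
  ring

theorem pb_det_det (hij : i ≠ j) (hik : i ≠ k) (hil : i ≠ l) (hjk : j ≠ k) (hjl : j ≠ l)
    (hkl : k ≠ l) : pb (det i j k) (det j k l) =
      det j k l * dot i j - det i k l * (dot j k + 2 * siteCas j) - det i j k * dot j l := by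
  have hl : ∀ σ, pb (det i j k) (J l σ) = 0 := pb_det_J_of_ne hil hjl hkl
  -- A transposition moves `j` to the last slot, the one that `pb_det_J` differentiates.
  have hj : ∀ σ, pb (det i j k) (J j σ) = -_ := fun σ => by
    rw [det_swap_right, map_neg, LinearMap.neg_apply, pb_det_J hij hjk.symm]
  have hk : ∀ σ, pb (det i j k) (J k σ) = _ := pb_det_J hik hjk
  -- Only the second form is expanded; the first enters solely through its brackets with the
  -- generators.
  conv_lhs => arg 2; rw [det]
  simp only [map_add, map_sub, pb_mul, hl, hj, hk, genBracket,
    ofNat_smul_eq_nsmul, nsmul_eq_mul, Nat.cast_ofNat, siteCas_eq]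
  simp only [dot, det]
  ring

theorem pb_det_det' (hik : i ≠ k) (hil : i ≠ l) (hip : i ≠ p) (hjk : j ≠ k)
    (hjl : j ≠ l) (hjp : j ≠ p) (hkl : k ≠ l) (hkp : k ≠ p) :
    pb (det i j k) (det k l p) = det i l p * dot j k - dot i k * det j l p := by
  have hl : ∀ σ, pb (det i j k) (J l σ) = 0 := pb_det_J_of_ne hil hjl hkl
  have hp : ∀ σ, pb (det i j k) (J p σ) = 0 := pb_det_J_of_ne hip hjp hkp
  conv_lhs => arg 2; rw [det]
  simp only [map_add, map_sub, pb_mul, hl, hp, pb_det_J hik hjk, genBracket,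
    ofNat_smul_eq_nsmul, nsmul_eq_mul, Nat.cast_ofNat]
  simp only [dot, det]
  ring

end Dot

/-- The image of `P_ij` in the tensor power. -/
def realP (i j : Fin n) : Chain n := if i = j then 0 else dot i j

theorem realP_of_ne {i j : Fin n} (h : i ≠ j) : realP i j = dot i j := if_neg h

theorem half_pb_realP {i j k : Fin n} (h : [i, j, k].Nodup) :
    (1 / 2 : ℝ) • pb (realP i j) (realP j k) = det i j k := by
  obtain ⟨hij, hik, hjk⟩ := Racah.nodup_three.1 h
  rw [realP_of_ne hij, realP_of_ne hjk, pb_dot_dot hij hik hjk, half_smul_two_mul]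

/-- The realisation `R(n) → 𝔄^{⊗n}`. -/
def realize (n : ℕ) : PoissonHom (Racah n) (Chain n) := by
  refine Racah.lift siteCas realP (fun i j k => (1 / 2 : ℝ) • pb (realP i j) (realP j k))
    (fun _ _ _ => rfl) (fun i j => ?_) (fun i => if_pos rfl) (fun i j => pb_siteCas i _)
    (fun i j k => pb_siteCas i _) ?_ ?_ ?_ ?_ ?_ ?_ ?_
  · simp only [realP, dot_comm, eq_comm]
  · intro i j k l h
    simp only [List.nodup_cons, List.mem_cons, not_or, List.not_mem_nil, not_false_eq_true,
      and_true, List.nodup_nil] at h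
    obtain ⟨⟨hij, hik, hil⟩, ⟨hjk, hjl⟩, hkl⟩ := h
    have h1 : ∀ σ, pb (dot i j) (J k σ) = 0 := pb_dot_J_of_ne hik hjk
    have h2 : ∀ σ, pb (dot i j) (J l σ) = 0 := pb_dot_J_of_ne hil hjl
    rw [realP_of_ne hij, realP_of_ne hkl]
    conv_lhs => arg 2; rw [dot]
    simp [pb_mul, pb_two, h1, h2]
  · intro i j k h
    obtain ⟨hij, hik, hjk⟩ := Racah.nodup_three.1 h
    rw [half_pb_realP h, half_pb_realP (Racah.nodup_three.2 ⟨hij.symm, hjk, hik⟩), det_swap_left]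
  · intro i j k h
    obtain ⟨hij, hik, hjk⟩ := Racah.nodup_three.1 h
    rw [half_pb_realP h, half_pb_realP (Racah.nodup_three.2 ⟨hik, hij, hjk.symm⟩), det_swap_right]
  · intro i j k h
    obtain ⟨hij, hik, hjk⟩ := Racah.nodup_three.1 h
    rw [half_pb_realP h, realP_of_ne hij, realP_of_ne hik, realP_of_ne hjk,
      pb_dot_det hij hik hjk]
  · intro i j k l h
    have h' := h
    simp only [List.nodup_cons, List.mem_cons, not_or, List.not_mem_nil, not_false_eq_true,
      and_true, List.nodup_nil] at h'
    obtain ⟨⟨hij, hik, hil⟩, ⟨hjk, hjl⟩, hkl⟩ := h'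
    rw [half_pb_realP (by simp_all), realP_of_ne hik, realP_of_ne hil, realP_of_ne hjk,
      realP_of_ne hjl, realP_of_ne hkl, pb_dot_det' hik hjk hil hjl hkl]
  · intro i j k l h
    have h' := h
    simp only [List.nodup_cons, List.mem_cons, not_or, List.not_mem_nil, not_false_eq_true,
      and_true, List.nodup_nil] at h'
    obtain ⟨⟨hij, hik, hil⟩, ⟨hjk, hjl⟩, hkl⟩ := h'
    rw [half_pb_realP (by simp_all), half_pb_realP (by simp_all), half_pb_realP (by simp_all),
      realP_of_ne hij, realP_of_ne hjk, realP_of_ne hjl, pb_det_det hij hik hil hjk hjl hkl]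
  · intro i j k l p h
    have h' := h
    simp only [List.nodup_cons, List.mem_cons, not_or, List.not_mem_nil, not_false_eq_true,
      and_true, List.nodup_nil] at h'
    obtain ⟨⟨hij, hik, hil, hip⟩, ⟨hjk, hjl, hjp⟩, ⟨hkl, hkp⟩, hlp⟩ := h'
    rw [half_pb_realP (by simp_all), half_pb_realP (by simp_all), half_pb_realP (by simp_all),
      half_pb_realP (by simp_all), realP_of_ne hik, realP_of_ne hjk,
      pb_det_det' hik hil hip hjk hjl hjp hkl hkp]

theorem realize_C (i : Fin n) : realize n (Racah.C i) = siteCas i := rfl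

theorem realize_P (i j : Fin n) : realize n (Racah.P i j) = realP i j := rfl

/-- The Casimir is a quadratic form with polarisation `dot`, evaluated here on a sum of vectors. -/
theorem two_mul_cas (A : Finset (Fin n)) : 2 * cas A = ∑ i ∈ A, ∑ j ∈ A, dot i j := by
  have h : ∀ σ τ, ∑ i ∈ A, ∑ j ∈ A, J i σ * J j τ = (∑ i ∈ A, J i σ) * ∑ j ∈ A, J j τ :=
    fun σ τ => (Finset.sum_mul_sum _ _ _ _).symm
  have h2 : ∀ σ τ, ∑ i ∈ A, ∑ j ∈ A, 2 * (J i σ * J j τ) =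
      2 * ((∑ i ∈ A, J i σ) * ∑ j ∈ A, J j τ) := fun σ τ => by
    simp only [← h, Finset.mul_sum]
  simp only [dot, Finset.sum_sub_distrib, h, mul_assoc, h2]
  rw [cas, casimirFun]
  ring

/-- The doubled expressions agree off the diagonal because `P i j` becomes `dot i j`. On the
diagonal `realP` is zero, and `2 C_i` supplies `dot i i`. -/
theorem realize_cas (A : Finset (Fin n)) : realize n (Racah.cas A) = cas A := by
  apply eq_of_two_mul_eq
  have h : ∀ x, 2 * realize n x = realize n (2 * x) := fun x => by
    rw [map_mul, map_ofNat]
  rw [h, Racah.two_mul_cas, two_mul_cas, map_add, ← h, Racah.blockP, map_sum, map_sum,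
    Finset.mul_sum, ← Finset.sum_add_distrib]
  refine Finset.sum_congr rfl fun i hi => ?_
  rw [realize_C, map_sum, ← dot_self]
  simp only [realize_P, realP]
  rw [← Finset.sum_erase_add _ _ hi, ← Finset.sum_erase_add _ (fun j => dot i j) hi, if_pos rfl,
    add_zero]
  congr 1
  exact Finset.sum_congr rfl fun j hj => if_neg (Finset.ne_of_mem_erase hj).symm

theorem range_realize (n : ℕ) : (realize n).range = racah n := by
  rw [(realize n).range_eq_adjoin Racah.mem_adjoin_cas, racah, ← Set.range_comp]
  congr 2
  exact funext realize_cas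

/-- The realisation, as a morphism onto its image. -/
def realizeRacah (n : ℕ) : PoissonHom (Racah n) (racah n).toSubalgebra :=
  (realize n).codRestrict (racah n) fun a => by
    rw [← range_realize]
    exact ⟨a, rfl⟩

theorem realizeRacah_cas (A : Finset (Fin n)) : realizeRacah n (Racah.cas A) = racahCas A :=
  Subtype.ext (realize_cas A)

theorem realizeRacah_surjective : Function.Surjective (realizeRacah n) := by
  rintro ⟨x, hx⟩
  rw [← range_realize] at hx
  obtain ⟨a, rfl⟩ := hx
  exact ⟨a, rfl⟩

/-! ### Merging sites of the tensor power -/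

/-- A morphism of algebras that respects the brackets of the generators is Poisson. -/
theorem map_pb_of_J {B : Type*} [CommRing B] [Algebra ℝ B] [PoissonAlgebra B]
    (φ : Chain n →ₐ[ℝ] B)
    (h : ∀ i σ j τ, φ (pb (J i σ) (J j τ)) = pb (φ (J i σ)) (φ (J j τ))) (f g : Chain n) :
    φ (pb f g) = pb (φ f) (φ g) := by
  have h1 : ∀ i σ g, φ (pb (J i σ) g) = pb (φ (J i σ)) (φ g) := by
    intro i σ g
    induction g using MvPolynomial.induction_on with
    | C r =>
      have : φ (MvPolynomial.C r) = algebraMap ℝ B r := φ.commutes r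
      rw [this, pb_algebraMap]
      exact (congrArg φ (pb_algebraMap _ r)).trans (map_zero φ)
    | add p q hp hq => simp only [map_add, hp, hq]
    | mul_X p v hp =>
      have hv := h i σ v.1 v.2
      change φ (pb (J i σ) (X v)) = pb (φ (J i σ)) (φ (X v)) at hv
      simp only [pb_mul, map_add, map_mul, hp, hv]
  induction f using MvPolynomial.induction_on with
  | C r =>
    have : φ (MvPolynomial.C r) = algebraMap ℝ B r := φ.commutes r
    rw [this, pb_anti, pb_anti (algebraMap ℝ B r), pb_algebraMap, map_neg]
    exact congrArg _ ((congrArg φ (pb_algebraMap _ r)).trans (map_zero φ))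
  | add p q hp hq => simp only [map_add, LinearMap.add_apply, hp, hq]
  | mul_X p v hp =>
    have hv := h1 v.1 v.2 g
    change φ (pb (X v) g) = pb (φ (X v)) (φ g) at hv
    simp only [pb_mul_left, map_add, map_mul, hp, hv]

/-- The substitution `J_σ^(q) ↦ ∑ J_σ^(i)` over `i` in `K q`. -/
def mergeAlg (K : Fin m → Finset (Fin n)) : Chain m →ₐ[ℝ] Chain n :=
  aeval fun v => ∑ i ∈ K v.1, J i v.2

theorem mergeAlg_J (K : Fin m → Finset (Fin n)) (q : Fin m) (σ : SL2Gen) :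
    mergeAlg K (J q σ) = ∑ i ∈ K q, J i σ := aeval_X _ _

/-- Merging the sites of disjoint blocks. -/
def merge (K : Fin m → Finset (Fin n)) (hK : Pairwise fun q r => Disjoint (K q) (K r)) :
    PoissonHom (Chain m) (Chain n) where
  toAlgHom := mergeAlg K
  map_pb' := by
    refine map_pb_of_J (mergeAlg K) fun q σ r τ => ?_
    rw [mergeAlg_J, mergeAlg_J]
    simp only [map_sum, LinearMap.sum_apply]
    rw [Finset.sum_comm]
    rcases eq_or_ne q r with rfl | h
    · rw [pb_J_self]
      -- Different sites commute, so only `i = j` contributes. As `genBracket` is linear in the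
      -- generators, summing over the block gives the bracket of the sums.
      have h1 : ∀ i ∈ K q, ∑ j ∈ K q, pb (J i σ) (J j τ) = genBracket i σ τ := fun i hi => by
        rw [Finset.sum_eq_single_of_mem i hi fun j _ hj => pb_J_of_ne hj.symm σ τ, pb_J_self]
      rw [Finset.sum_congr rfl h1]
      cases σ <;> cases τ <;> simp [genBracket, mergeAlg_J, Finset.smul_sum]
    · rw [pb_J_of_ne h, map_zero]
      refine (Finset.sum_eq_zero fun i hi => Finset.sum_eq_zero fun j hj => ?_).symm
      exact pb_J_of_ne (i := i) (j := j) (fun hij => Finset.disjoint_left.1 (hK h) hi (hij ▸ hj)) σ τ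

theorem map_casimirFun {B : Type*} [CommRing B] [Algebra ℝ B] (φ : Chain n →ₐ[ℝ] B)
    (j : SL2Gen → Chain n) :
    φ (casimirFun j) = φ (j three) ^ 2 - φ (j plus) * φ (j minus) := by
  simp [casimirFun]

section Merge

variable {K : Fin m → Finset (Fin n)} (hK : Pairwise fun q r => Disjoint (K q) (K r))

theorem merge_J (q : Fin m) (σ : SL2Gen) : merge K hK (J q σ) = ∑ i ∈ K q, J i σ :=
  mergeAlg_J K q σ

theorem merge_cas (B : Finset (Fin m)) : merge K hK (cas B) = cas (B.biUnion K) := by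
  have h : ∀ σ, merge K hK (∑ q ∈ B, J q σ) = ∑ i ∈ B.biUnion K, J i σ := fun σ => by
    rw [map_sum, Finset.sum_biUnion fun r _ s _ hrs => hK hrs]
    exact Finset.sum_congr rfl fun q _ => merge_J hK q σ
  rw [cas, map_casimirFun, h, h, h, cas, casimirFun]

theorem merge_injective (hne : ∀ q, (K q).Nonempty) : Function.Injective (merge K hK) := by
  choose r hr using hne
  have hrK : ∀ q p, r p ∈ K q → p = q := fun q p h => by
    by_contra hpq
    exact Finset.disjoint_left.1 (hK hpq) (hr p) h
  have hinj : Function.Injective r := fun p q h => hrK q p (h ▸ hr q)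
  have hs := hinj.isPartialInv
  -- A left inverse of algebras suffices for injectivity: the chosen sites are mapped back to their
  -- blocks, and the default `0` removes all others.
  let ψ : Chain n →ₐ[ℝ] Chain m :=
    aeval fun v => ((Function.partialInv r v.1).map fun q => J q v.2).getD 0
  have key : ∀ x, ψ (merge K hK x) = x := by
    refine fun x => congrArg (fun φ : Chain m →ₐ[ℝ] Chain m => φ x)
      (?_ : ψ.comp (merge K hK).toAlgHom = AlgHom.id ℝ _)
    refine MvPolynomial.algHom_ext fun v => ?_
    obtain ⟨q, σ⟩ := v
    change ψ (merge K hK (J q σ)) = J q σ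
    rw [merge_J, map_sum, Finset.sum_eq_single_of_mem (r q) (hr q)]
    · simp [ψ, J, (hs q (r q)).2 rfl]
    · intro i hi hiq
      rcases h : Function.partialInv r i with _ | p
      · simp [ψ, J, h]
      · have h' := (hs _ _).1 h
        obtain rfl : p = q := hrK q p (h'.symm ▸ hi)
        exact absurd h'.symm hiq
  exact Function.LeftInverse.injective key

end Merge

/-! ### The left and right Casimirs -/

/-- Applying the coproduct at the last site splits the last summand into two and leaves the other
summands in place. -/
theorem coprodL_J (m : ℕ) (σ : SL2Gen) : coprodL m (J 0 σ) = ∑ i, J i σ := by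
  induction m with
  | zero => simp [coprodL]
  | succ m ih =>
    rw [coprodL, AlgHom.comp_apply, ih, map_sum, Fin.sum_univ_castSucc,
      Fin.sum_univ_castSucc (n := m + 1), Fin.sum_univ_castSucc (n := m)]
    refine Eq.trans ?_ (add_assoc _ _ _).symm
    congr 1
    · refine Finset.sum_congr rfl fun i _ => ?_
      simp [coprodLast, J, i.castSucc_lt_last.ne]
    · simp [coprodLast, J]

theorem coprodR_J (m : ℕ) (σ : SL2Gen) : coprodR m (J 0 σ) = ∑ i, J i σ := by
  induction m with
  | zero => simp [coprodR]
  | succ m ih =>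
    rw [coprodR, AlgHom.comp_apply, ih, map_sum, Fin.sum_univ_succ,
      Fin.sum_univ_succ (n := m + 1), Fin.sum_univ_succ (n := m)]
    refine Eq.trans ?_ (add_assoc _ _ _)
    congr 1
    · simp [coprodFirst, J]
    · refine Finset.sum_congr rfl fun i _ => ?_
      simp [coprodFirst, J]

theorem left_eq_cas {m : ℕ} (h1 : 1 ≤ m) (hm : m ≤ n) :
    left n m = cas {i | i.val + 1 ≤ m} := by
  obtain ⟨m, rfl⟩ := Nat.exists_eq_add_of_le' h1
  have key : ∀ σ, rename (R := ℝ) (fun v : Fin (m + 1 - 1 + 1) × SL2Gen =>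
      ((⟨v.1.val, by omega⟩ : Fin n), v.2)) (coprodL (m + 1 - 1) (J 0 σ)) =
        ∑ i : Fin n with i.val + 1 ≤ m + 1, J i σ := fun σ => by
    rw [coprodL_J, map_sum]
    refine Finset.sum_bij (fun i _ => (⟨i.val, by omega⟩ : Fin n)) ?_ ?_ ?_ ?_
    · intro i _
      simp; omega
    · intro i _ j _ hij
      simpa [Fin.ext_iff] using hij
    · intro i hi
      simp only [Finset.mem_filter, Finset.mem_univ, true_and] at hi
      exact ⟨⟨i.val, by omega⟩, Finset.mem_univ _, rfl⟩
    · intro i _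
      simp [J]
  rw [left, upperCas, dif_pos ⟨h1, hm⟩, casimir, map_casimirFun, map_sub, map_mul, map_pow, key,
    key, key, cas, casimirFun]

theorem right_eq_cas {m : ℕ} (h1 : 1 ≤ m) (hm : m ≤ n) :
    right n m = cas {i | m ≤ i.val + 1} := by
  have key : ∀ σ, rename (R := ℝ) (fun v : Fin (n + 1 - m - 1 + 1) × SL2Gen =>
      ((⟨n - (n + 1 - m) + v.1.val, by omega⟩ : Fin n), v.2)) (coprodR (n + 1 - m - 1) (J 0 σ)) =
        ∑ i : Fin n with m ≤ i.val + 1, J i σ := fun σ => by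
    rw [coprodR_J, map_sum]
    -- The shift `n - (n + 1 - m)` is `m - 1`, the zero-based position of site `m`; its inverse
    -- sends `i` to `i + 1 - m`.
    refine Finset.sum_bij (fun i _ => (⟨n - (n + 1 - m) + i.val, by omega⟩ : Fin n)) ?_ ?_ ?_ ?_
    · intro i _
      simp; omega
    · intro i _ j _ hij
      simpa [Fin.ext_iff] using hij
    · intro i hi
      simp only [Finset.mem_filter, Finset.mem_univ, true_and] at hi
      refine ⟨⟨i.val + 1 - m, by omega⟩, Finset.mem_univ _, ?_⟩
      ext
      simp; omega
    · intro i _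
      simp [J]
  rw [right, lowerCas, dif_pos ⟨by omega, by omega⟩, casimir, map_casimirFun, map_sub, map_mul,
    map_pow, key, key, key, cas, casimirFun]

end Chain

/-! ### The relations of `R(3)` in terms of the Casimirs -/

namespace Racah

theorem cas_pair {n : ℕ} {i j : Fin n} (h : i ≠ j) : cas {i, j} = C i + C j + P i j := by
  rw [P_eq_cas h, cas_singleton, cas_singleton]; ring

theorem cas_three : cas ({0, 1, 2} : Finset (Fin 3)) =
    C 0 + C 1 + C 2 + P 0 1 + P 0 2 + P 1 2 := by
  rw [cas_insert (by decide), cas_pair (by decide), Finset.sum_pair (by decide)]; ring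

/-- Up to central terms the total Casimir of `R(3)` is this sum of three generators, so the lemma
and its permutations give its centrality. -/
theorem pb_P_sum {n : ℕ} {i j k : Fin n} (h : [i, j, k].Nodup) :
    pb (P i j + P i k + P j k) (P i j) = 0 := by
  have := pb_P_add h
  rw [map_add, map_add, LinearMap.add_apply, LinearMap.add_apply, pb_self, pb_anti (P i k),
    pb_anti (P j k)]
  linear_combination -this

/-- The total Casimir of `R(3)` is central. -/
theorem pb_cas_three (a : Racah 3) : pb (cas {0, 1, 2}) a = 0 := by
  refine PresentedPoisson.mem_of_forall_gen (PoissonSubalgebra.commutant _) ?_ a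
  have hcas : ∀ b : Racah 3, pb (cas {0, 1, 2}) b = pb (P 0 1 + P 0 2 + P 1 2) b := fun b => by
    rw [cas_three]
    simp only [map_add, LinearMap.add_apply, pb_C, zero_add]
  have h01 : pb (cas {0, 1, 2}) (P (0 : Fin 3) 1) = 0 := (hcas _).trans (pb_P_sum (by decide))
  have h02 : pb (cas {0, 1, 2}) (P (0 : Fin 3) 2) = 0 := by
    rw [hcas, ← pb_P_sum (i := (0 : Fin 3)) (j := 2) (k := 1) (by decide), P_symm 2 1,
      add_comm (P (0 : Fin 3) 2) (P 0 1)]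
  have h12 : pb (cas {0, 1, 2}) (P (1 : Fin 3) 2) = 0 := by
    rw [hcas, ← pb_P_sum (i := (1 : Fin 3)) (j := 2) (k := 0) (by decide), P_symm 1 0,
      P_symm 2 0, add_comm (P (0 : Fin 3) 1 + P 0 2) (P 1 2), add_assoc]
  rintro (i | ⟨i, j⟩)
  · exact pb_C_right i _
  · change pb (cas {0, 1, 2}) (P i j) = 0
    fin_cases i <;> fin_cases j <;>
      simp only [Fin.zero_eta, Fin.mk_one, Fin.reduceFinMk, P_diag, map_zero, h01, h02, h12,
        P_symm 1 0, P_symm 2 0, P_symm 2 1]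

theorem F_cyclic {n : ℕ} {i j k : Fin n} (h : [i, j, k].Nodup) : F i j k = F j k i := by
  obtain ⟨h1, h2, h3⟩ := nodup_three.1 h
  rw [F_swap_left h, F_swap_right (nodup_three.2 ⟨h1.symm, h3, h2⟩), neg_neg]

end Racah

/-! ### Image, quadratic relations and the embedding criterion. -/

section Embedding

open Racah (cas C P F)

variable {Y : Type*} [CommRing Y] [Algebra ℝ Y] [PoissonAlgebra Y]

/-- `ψ` maps the Casimirs of `R(3)` to the left and right Casimirs. -/
structure MapsCasimirs (n k : ℕ) (L R : ℕ → Y) (Ck : Y) (ψ : PoissonHom (Racah 3) Y) : Prop where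
  one : ψ (cas {0}) = L (k - 1)
  two : ψ (cas {1}) = Ck
  three : ψ (cas {2}) = R (k + 1)
  one_two : ψ (cas {0, 1}) = L k
  two_three : ψ (cas {1, 2}) = R k
  one_two_three : ψ (cas {0, 1, 2}) = L n

variable {n k : ℕ} {L R : ℕ → Y} {Ck : Y} {ψ : PoissonHom (Racah 3) Y}

/-- Inclusion-exclusion for a quadratic expression: `C_13 = C_123 - C_12 - C_23 + C_1 + C_2 + C_3`.
-/
theorem MapsCasimirs.one_three (h : MapsCasimirs n k L R Ck ψ) :
    ψ (cas {0, 2}) = midCas n k L R Ck := by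
  rw [midCas, ← h.one, ← h.two, ← h.three, ← h.one_two, ← h.two_three, ← h.one_two_three]
  simp only [Racah.cas_three, Racah.cas_singleton, Racah.cas_pair (show (0 : Fin 3) ≠ 1 by decide),
    Racah.cas_pair (show (0 : Fin 3) ≠ 2 by decide),
    Racah.cas_pair (show (1 : Fin 3) ≠ 2 by decide), map_add]
  ring

/-- Of the eight Casimirs of `R(3)` the empty one is zero, six map to the generators of the
substructure, and `C_13` maps to a linear combination of these. -/
theorem MapsCasimirs.range_eq_substructure (h : MapsCasimirs n k L R Ck ψ) :
    ψ.range = substructure n k L R Ck := by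
  rw [ψ.range_eq_adjoin Racah.mem_adjoin_cas, substructure]
  refine PoissonSubalgebra.adjoin_eq_adjoin ?_ ?_
  · have hg := PoissonSubalgebra.subset_adjoin {L (k - 1), Ck, R (k + 1), L k, R k, L n}
    simp only [Set.insert_subset_iff, Set.singleton_subset_iff] at hg
    obtain ⟨h1, h2, h3, h4, h5, h6⟩ := hg
    rintro _ ⟨_, ⟨B, rfl⟩, rfl⟩
    have hB : ∀ B : Finset (Fin 3), B = ∅ ∨ B = {0} ∨ B = {1} ∨ B = {2} ∨ B = {0, 1} ∨
      B = {1, 2} ∨ B = {0, 2} ∨ B = {0, 1, 2} := by decide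
    rcases hB B with rfl | rfl | rfl | rfl | rfl | rfl | rfl | rfl
    · rw [Racah.cas_empty, map_zero]
      exact PoissonSubalgebra.zero_mem _
    · rwa [h.one]
    · rwa [h.two]
    · rwa [h.three]
    · rwa [h.one_two]
    · rwa [h.two_three]
    · rw [h.one_three, midCas]
      exact PoissonSubalgebra.add_mem (PoissonSubalgebra.add_mem (PoissonSubalgebra.add_mem
        (PoissonSubalgebra.sub_mem (PoissonSubalgebra.sub_mem h6 h4) h5) h1) h2) h3
    · rwa [h.one_two_three]
  · have hc : ∀ B, ψ (cas B) ∈ (PoissonSubalgebra.adjoin (ψ '' Set.range cas)).carrier :=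
      fun B => PoissonSubalgebra.subset_adjoin _ ⟨_, ⟨B, rfl⟩, rfl⟩
    simp only [Set.insert_subset_iff, Set.singleton_subset_iff, ← h.one, ← h.two, ← h.three,
      ← h.one_two, ← h.two_three, ← h.one_two_three, hc, and_self]

theorem substructure_eq_adjoin (n k : ℕ) (L R : ℕ → Y) (Ck : Y) :
    substructure n k L R Ck = PoissonSubalgebra.adjoin
      {L (k - 1), Ck, R (k + 1), L k, R k, midCas n k L R Ck, L n} := by
  have hg := PoissonSubalgebra.subset_adjoin {L (k - 1), Ck, R (k + 1), L k, R k, L n}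
  simp only [Set.insert_subset_iff, Set.singleton_subset_iff] at hg
  obtain ⟨h1, h2, h3, h4, h5, h6⟩ := hg
  refine PoissonSubalgebra.adjoin_eq_adjoin ?_ ?_
  · refine Set.Subset.trans ?_ (PoissonSubalgebra.subset_adjoin _)
    simp only [Set.insert_subset_iff, Set.singleton_subset_iff]
    simp
  · simp only [Set.insert_subset_iff, Set.singleton_subset_iff]
    refine ⟨h1, h2, h3, h4, h5, ?_, h6⟩
    exact PoissonSubalgebra.add_mem (PoissonSubalgebra.add_mem (PoissonSubalgebra.add_mem
      (PoissonSubalgebra.sub_mem (PoissonSubalgebra.sub_mem h6 h4) h5) h1) h2) h3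

theorem MapsCasimirs.relations (h : MapsCasimirs n k L R Ck ψ) :
    QuadraticRelations n k L R Ck := by
  have h01 : (0 : Fin 3) ≠ 1 := by decide
  have h02 : (0 : Fin 3) ≠ 2 := by decide
  have h12 : (1 : Fin 3) ≠ 2 := by decide
  have hC : ∀ i y, pb (ψ (C i)) (ψ y) = 0 := fun i y => by
    rw [← ψ.map_pb, Racah.pb_C, map_zero]
  have hC' : ∀ i y, pb (ψ y) (ψ (C i)) = 0 := fun i y => by
    rw [← ψ.map_pb, Racah.pb_C_right, map_zero]
  have e1 : L (k - 1) = ψ (C 0) := by rw [← h.one, Racah.cas_singleton]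
  have e2 : Ck = ψ (C 1) := by rw [← h.two, Racah.cas_singleton]
  have e3 : R (k + 1) = ψ (C 2) := by rw [← h.three, Racah.cas_singleton]
  have e12 : L k = ψ (C 0) + ψ (C 1) + ψ (P 0 1) := by
    rw [← h.one_two, Racah.cas_pair h01, map_add, map_add]
  have e23 : R k = ψ (C 1) + ψ (C 2) + ψ (P 1 2) := by
    rw [← h.two_three, Racah.cas_pair h12, map_add, map_add]
  have e13 : midCas n k L R Ck = ψ (C 0) + ψ (C 2) + ψ (P 0 2) := by
    rw [← h.one_three, Racah.cas_pair h02, map_add, map_add]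
  have e123 : L n = ψ (C 0) + ψ (C 1) + ψ (C 2) + ψ (P 0 1) + ψ (P 0 2) + ψ (P 1 2) := by
    rw [← h.one_two_three, Racah.cas_three]
    simp only [map_add]
  have hF : ∀ i j l : Fin 3, (1 / 2 : ℝ) • pb (ψ (P i j)) (ψ (P j l)) = ψ (F i j l) :=
    fun i j l => by rw [← ψ.map_pb, F, map_smul]
  -- `pb_P_F` gives the bracket of `F i j k` with `P j k` only; cyclic rotations of the same `F`
  -- provide the brackets with the other two generators.
  have hF12 : F 1 2 0 = F (0 : Fin 3) 1 2 := (Racah.F_cyclic (by decide)).symm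
  have hF20 : F 2 0 1 = F (0 : Fin 3) 1 2 := Racah.F_cyclic (by decide)
  have hFk : bracketCas k L R = ψ (F 0 1 2) := by
    rw [bracketCas, e12, e23, ← hF]
    simp only [map_add, LinearMap.add_apply, hC, hC', zero_add]
  have b01 : pb (ψ (P 0 1)) (ψ (F 0 1 2)) = ψ (P 1 2) * ψ (P 0 1) - ψ (P 0 1) * ψ (P 0 2)
      + 2 * ψ (P 1 2) * ψ (C 0) - 2 * ψ (P 0 2) * ψ (C 1) := by
    rw [← ψ.map_pb, ← hF20, Racah.pb_P_F (by decide), Racah.P_symm 2 1, Racah.P_symm 2 0]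
    simp only [map_add, map_sub, map_mul, map_ofNat]
  have b12 : pb (ψ (P 1 2)) (ψ (F 0 1 2)) = ψ (P 0 2) * ψ (P 1 2) - ψ (P 1 2) * ψ (P 0 1)
      + 2 * ψ (P 0 2) * ψ (C 1) - 2 * ψ (P 0 1) * ψ (C 2) := by
    rw [← ψ.map_pb, Racah.pb_P_F (by decide)]
    simp only [map_add, map_sub, map_mul, map_ofNat]
  have b02 : pb (ψ (P 0 2)) (ψ (F 0 1 2)) = ψ (P 0 1) * ψ (P 0 2) - ψ (P 0 2) * ψ (P 1 2)
      + 2 * ψ (P 0 1) * ψ (C 2) - 2 * ψ (P 1 2) * ψ (C 0) := by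
    rw [← ψ.map_pb, ← hF12, Racah.P_symm 0 2, Racah.pb_P_F (by decide), Racah.P_symm 1 0,
      Racah.P_symm 2 0]
    simp only [map_add, map_sub, map_mul, map_ofNat]
  refine ⟨?_, ?_, ?_, ?_, ?_, ?_, ?_, ?_⟩
  · intro z hz y hy
    -- Every element of the substructure is an image under `ψ`, so centrality can be checked in
    -- `R(3)`.
    rw [← h.range_eq_substructure] at hy
    obtain ⟨x, rfl⟩ := hy
    simp only [Set.mem_insert_iff, Set.mem_singleton_iff] at hz
    rcases hz with rfl | rfl | rfl | rfl
    · rw [e1]; exact hC _ _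
    · rw [e2]; exact hC _ _
    · rw [e3]; exact hC _ _
    · rw [← h.one_two_three]
      exact (ψ.map_pb _ _).symm.trans (by rw [Racah.pb_cas_three, map_zero])
  · rw [hFk, e13, e23, ← hF12, ← hF, Racah.P_symm 2 0]
    simp only [map_add, LinearMap.add_apply, hC, hC', zero_add]
  · rw [hFk, e13, e12, ← hF20, ← hF, Racah.P_symm 2 0]
    simp only [map_add, LinearMap.add_apply, hC, hC', zero_add]
  -- In terms of the images of `C i` and `P i j` the central parts drop out of the bracket, leaving
  -- a polynomial identity.
  · rw [hFk, e13, e123, e12, e23, e1, e2, e3]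
    simp only [map_add, LinearMap.add_apply, hC, b01]
    ring
  · rw [hFk, e13, e123, e12, e23, e1, e2, e3]
    simp only [map_add, LinearMap.add_apply, hC, b12]
    ring
  · rw [hFk, e13, e123, e12, e23, e1, e2, e3]
    simp only [map_add, LinearMap.add_apply, hC, b02]
    ring
  · rw [hFk, e123, e12, e23, e1, e2, e3]
    simp only [map_add, LinearMap.add_apply, hC, b01]
    ring
  · rw [hFk, e123, e12, e23, e1, e2, e3]
    simp only [map_add, LinearMap.add_apply, hC, b12]
    ring

/-- An injective morphism with the prescribed values on the Casimirs is a Racah embedding, when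
its source is a quotient of `R(3)`. -/
theorem isRacahEmbedding_of_map_cas {X : Type*} [CommRing X] [Algebra ℝ X] [PoissonAlgebra X]
    {c : Finset (Fin 3) → X} {Cas : Finset (Fin n) → Y} {ρ : PoissonHom (Racah 3) X}
    {θ : PoissonHom X Y} (hρ : Function.Surjective ρ) (hc : ∀ B, ρ (cas B) = c B)
    (hθ : ∀ B, θ (c B) = Cas (B.biUnion (siteBlock n k))) (hinj : Function.Injective θ)
    (h : MapsCasimirs n k L R Ck (θ.comp ρ)) (total : L n = R 1) :
    IsRacahEmbedding n k c Cas L R Ck θ := by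
  have hrange : θ.range = (θ.comp ρ).range := by
    refine PoissonSubalgebra.ext_carrier (Set.Subset.antisymm ?_ ?_)
    · rintro _ ⟨x, rfl⟩
      obtain ⟨a, rfl⟩ := hρ x
      exact ⟨a, rfl⟩
    · rintro _ ⟨a, rfl⟩
      exact ⟨ρ a, rfl⟩
  have hS : θ.range = substructure n k L R Ck := hrange.trans h.range_eq_substructure
  refine ⟨hθ, fun θ' hθ' => PoissonHom.ext fun x => ?_, hinj, ?_, ?_, ?_, ?_, ?_, ?_, ?_, total,
    hS.trans (substructure_eq_adjoin n k L R Ck), hS, h.relations,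
    θ.nonempty_equiv_range hinj hS⟩
  · obtain ⟨a, rfl⟩ := hρ x
    refine Racah.hom_ext_cas (φ := θ'.comp ρ) (ψ := θ.comp ρ) (fun B => ?_) a
    simp only [PoissonHom.comp_apply, hc, hθ, hθ']
  · rw [← hc]; exact h.one
  · rw [← hc]; exact h.two
  · rw [← hc]; exact h.three
  · rw [← hc]; exact h.one_two
  · rw [← hc]; exact h.two_three
  · rw [← hc]; exact h.one_three
  · rw [← hc]; exact h.one_two_three

end Embedding

/-! ### The three blocks of sites -/

section Blocks

variable {n k : ℕ}

theorem mem_siteBlock_zero {i : Fin n} : i ∈ siteBlock n k 0 ↔ i.val + 1 < k := by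
  simp [siteBlock]

theorem mem_siteBlock_one {i : Fin n} : i ∈ siteBlock n k 1 ↔ i.val + 1 = k := by
  simp [siteBlock]

theorem mem_siteBlock_two {i : Fin n} : i ∈ siteBlock n k 2 ↔ k < i.val + 1 := by
  simp [siteBlock]

theorem siteBlock_disjoint (n k : ℕ) :
    Pairwise fun q r => Disjoint (siteBlock n k q) (siteBlock n k r) := by
  intro q r hqr
  refine Finset.disjoint_left.2 fun i hi hi' => ?_
  fin_cases q <;> fin_cases r <;>
    simp only [Fin.zero_eta, Fin.mk_one, Fin.reduceFinMk, mem_siteBlock_zero, mem_siteBlock_one,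
      mem_siteBlock_two, ne_eq, not_true_eq_false] at hi hi' hqr <;> omega

theorem siteBlock_nonempty (hk : 2 ≤ k) (hkn : k < n) (q : Fin 3) :
    (siteBlock n k q).Nonempty := by
  fin_cases q
  -- The witnesses are the sites `1`, `k` and `n`, numbered from zero.
  · exact ⟨⟨0, by omega⟩, mem_siteBlock_zero.2 (by simp; omega)⟩
  · exact ⟨⟨k - 1, by omega⟩, mem_siteBlock_one.2 (by simp; omega)⟩
  · exact ⟨⟨n - 1, by omega⟩, mem_siteBlock_two.2 (by simp; omega)⟩

/-- A morphism with the prescribed values on the Casimirs of blocks maps the Casimirs of `R(3)`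
to the left and right Casimirs. -/
theorem mapsCasimirs_of_map_cas {Y : Type*} [CommRing Y] [Algebra ℝ Y] [PoissonAlgebra Y]
    {L R : ℕ → Y} {Ck : Y} {ψ : PoissonHom (Racah 3) Y} {Cas : Finset (Fin n) → Y}
    (hk : 2 ≤ k) (hkn : k < n)
    (hψ : ∀ B, ψ (Racah.cas B) = Cas (B.biUnion (siteBlock n k)))
    (hL : ∀ m, 1 ≤ m → m ≤ n → L m = Cas {i | i.val + 1 ≤ m})
    (hR : ∀ m, 1 ≤ m → m ≤ n → R m = Cas {i | m ≤ i.val + 1})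
    (hC : Ck = Cas {⟨k - 1, by omega⟩}) : MapsCasimirs n k L R Ck ψ := by
  refine ⟨?_, ?_, ?_, ?_, ?_, ?_⟩
  · rw [hψ, hL _ (by omega) (by omega)]
    congr 1
    ext i
    simp [mem_siteBlock_zero]; omega
  · rw [hψ, hC]
    congr 1
    ext i
    simp [mem_siteBlock_one, Fin.ext_iff]; omega
  · rw [hψ, hR _ (by omega) (by omega)]
    congr 1
    ext i
    simp [mem_siteBlock_two]
  · rw [hψ, hL _ (by omega) (by omega)]
    congr 1
    ext i
    simp [mem_siteBlock_zero, mem_siteBlock_one]; omega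
  · rw [hψ, hR _ (by omega) (by omega)]
    congr 1
    ext i
    simp [mem_siteBlock_two, mem_siteBlock_one]; omega
  · rw [hψ, hL _ (by omega) (by omega)]
    congr 1
    ext i
    simp [mem_siteBlock_zero, mem_siteBlock_two, mem_siteBlock_one]; omega

theorem casimir_total {Y : Type*} {L R : ℕ → Y} {Cas : Finset (Fin n) → Y} (hn : 1 ≤ n)
    (hL : ∀ m, 1 ≤ m → m ≤ n → L m = Cas {i | i.val + 1 ≤ m})
    (hR : ∀ m, 1 ≤ m → m ≤ n → R m = Cas {i | m ≤ i.val + 1}) : L n = R 1 := by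
  rw [hL n hn le_rfl, hR 1 le_rfl hn]
  congr 1
  ext i
  simp

end Blocks

end

/-! ### Assembly of both embeddings and the realisation square. -/

theorem proposition1 (n : ℕ) (hn : 3 < n) (k : ℕ) (hk : 2 ≤ k) (hkn : k ≤ n - 1) :
    ∃ (θ : PoissonHom (Racah 3) (Racah n))
      (θc : PoissonHom (Chain.racah 3).toSubalgebra (Chain n))
      (ρ₃ : PoissonHom (Racah 3) (Chain.racah 3).toSubalgebra)
      (ρ : PoissonHom (Racah n) (Chain n)),
      -- the presented Racah algebras
      IsRacahEmbedding n k Racah.cas Racah.cas (Racah.left n) (Racah.right n)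
        (Racah.C ⟨k - 1, by omega⟩) θ ∧
      -- the Racah algebras realised in the tensor powers of the Poisson coalgebra `sl(2, ℝ)`
      IsRacahEmbedding n k Chain.racahCas Chain.cas (Chain.left n) (Chain.right n)
        (Chain.siteCas ⟨k - 1, by omega⟩) θc ∧
      (∀ x, θc x ∈ (Chain.racah n).toSubalgebra) ∧
      -- the realisation maps
      (∀ B, ρ₃ (Racah.cas B) = Chain.racahCas B) ∧
      Function.Surjective ρ₃ ∧
      (∀ A, ρ (Racah.cas A) = Chain.cas A) ∧
      ρ.range = Chain.racah n ∧
      (∀ m, 1 ≤ m → m ≤ n → ρ (Racah.left n m) = Chain.left n m ∧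
        ρ (Racah.right n m) = Chain.right n m) ∧
      (∀ x, ρ (θ x) = θc (ρ₃ x)) := by
  have hkn' : k < n := by omega
  have hK := siteBlock_disjoint n k
  have hne := siteBlock_nonempty hk hkn'
  set θ := Racah.merge (siteBlock n k) hK
  -- In the coalgebra the embedding is the restriction of a substitution defined on the whole tensor
  -- power.
  set θc := (Chain.merge (siteBlock n k) hK).comp (Chain.racah 3).subtype
  have hθ : ∀ B, θ (Racah.cas B) = Racah.cas (B.biUnion (siteBlock n k)) := Racah.merge_cas hK
  have hθc : ∀ B, θc (Chain.racahCas B) = Chain.cas (B.biUnion (siteBlock n k)) :=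
    Chain.merge_cas hK
  have hcomm : ∀ x, Chain.realize n (θ x) = θc (Chain.realizeRacah 3 x) :=
    Racah.hom_ext_cas (φ := (Chain.realize n).comp θ) (ψ := θc.comp (Chain.realizeRacah 3))
      fun B => by
        simp only [PoissonHom.comp_apply, hθ, Chain.realize_cas, Chain.realizeRacah_cas, hθc]
  refine ⟨θ, θc, Chain.realizeRacah 3, Chain.realize n, ?_, ?_, ?_, Chain.realizeRacah_cas,
    Chain.realizeRacah_surjective, Chain.realize_cas, Chain.range_realize n, ?_, hcomm⟩
  · refine isRacahEmbedding_of_map_cas (ρ := PoissonHom.id _) Function.surjective_id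
      (fun _ => rfl) hθ (Racah.merge_injective hK hne)
      (mapsCasimirs_of_map_cas hk hkn' hθ (fun _ _ _ => rfl) (fun _ _ _ => rfl)
        (Racah.cas_singleton _).symm)
      (casimir_total (by omega) (fun _ _ _ => rfl) (fun _ _ _ => rfl))
  · refine isRacahEmbedding_of_map_cas (ρ := Chain.realizeRacah 3) Chain.realizeRacah_surjective
      Chain.realizeRacah_cas hθc ((Chain.merge_injective hK hne).comp Subtype.val_injective)
      (mapsCasimirs_of_map_cas hk hkn' (fun B => ?_) (fun _ => Chain.left_eq_cas)
        (fun _ => Chain.right_eq_cas) ?_)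
      (casimir_total (by omega) (fun _ => Chain.left_eq_cas) (fun _ => Chain.right_eq_cas))
    · rw [PoissonHom.comp_apply, Chain.realizeRacah_cas, hθc]
    · rw [Chain.siteCas, Chain.cas]
      simp only [Finset.sum_singleton]
  · intro x
    -- By the commuting square, the value at a realised element is the realisation of an element of
    -- `R(n)`.
    obtain ⟨a, rfl⟩ := Chain.realizeRacah_surjective x
    rw [← hcomm, ← Chain.range_realize]
    exact ⟨θ a, rfl⟩
  · intro m h1 hm
    rw [Racah.left, Racah.right, Chain.realize_cas, Chain.realize_cas, Chain.left_eq_cas h1 hm,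
      Chain.right_eq_cas h1 hm]
    exact ⟨rfl, rfl⟩
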